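/- Let $\mathbb{K}$ be an algebraically closed field and let $Q$ be a proper radical ideal of $\mathbb{K}[[X_1,\dots,X_n]]$ whose minimal primes $P_1,\dots,P_r$ are pairwise distinct, with $r\ge 2$, such that every $\mathcal{O}_i=\mathbb{K}[[X_1,\dots,X_n]]/P_i$ has Krull dimension one (an algebroid curve with $r$ branches). Let $\mathcal{O}=\mathbb{K}[[X_1,\dots,X_n]]/Q$, with maximal ideal $\mathcal{M}$. For $g\in\mathcal{O}$ let $v(g)=(v_1(g),\dots,v_r(g))\in(\mathbb{N}\cup\{\infty\})^r$, where $v_i(g)$ is the value of the image of $g$ in $\mathcal{O}_i$ under the normalized discrete valuation of the integral closure of $\mathcal{O}_i$ in its fraction field, with $v_i(0)=\infty$. Let $\Gamma=v(\mathcal{O})$, a semiring under componentwise minimum (as sum) and componentwise addition (as product). For $G\subseteq\mathcal{M}$, a $G$-product is a finite product of elements of $G$, repetitions and the empty product $1$ being allowed. A nonzero $g\in\mathcal{O}$ has a reduction modulo $G$ if there are $c\in\mathbb{K}$, a $G$-product $p$ and an index $k$ with $v_k(g)<\infty$ such that $h=g-cp$ satisfies $v_i(h)\ge v_i(g)$ for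 all $i$ and $v_k(h)>v_k(g)$. A Standard Basis for $\mathcal{O}$ is a nonempty finite set $G\subseteq\mathcal{M}\setminus\{0\}$ modulo which every nonzero element of $\mathcal{O}$ has a reduction; it is minimal if no $g\in G$ has a reduction modulo $G\setminus\{g\}$. An element $\gamma\in\Gamma$, $\gamma\neq(0,\dots,0)$, is irreducible if $\gamma=\alpha+\beta$ with $\alpha,\beta\in\Gamma$ implies $\alpha=\gamma$ or $\beta=\gamma$. Put $I_\gamma=\{i:\gamma_i\ne\infty\}$. An element $\gamma\in\Gamma$ is an absolute point of $\Gamma$ if for no nonempty proper subset $J\subsetneq I_\gamma$ there is $\alpha\in\Gamma$ with $\alpha_i>\gamma_i$ for $i\in I_\gamma\setminus J$ and $\alpha_j=\gamma_j$ for all $j\notin I_\gamma\setminus J$. A subset $V\subseteq\Gamma$ generates the semiring $\Gamma$ if every $\gamma\in\Gamma$ is the componentwise minimum of $s$ elements, for some $1\le s\le r$ depending on $\gamma$, each of which is a finite sum of elements of $V$ (repetitions and the empty sum $(0,\dots,0)$ being allowed). Theorem. Let $G$ be a Standard Basis for $\mathcal{O}$ whose elements have pairwise distinct values under $v$. Then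 $G$ is minimal if and only if $v(G)$ is exactly the set of irreducible absolute points of $\Gamma$. Moreover, $\Gamma$ is minimally generated by its irreducible absolute points: they form a finite set that generates the semiring $\Gamma$ and is contained in every subset of $\Gamma$ that generates $\Gamma$. -/

import Mathlib

/-- For a ring `B` and `b : B`, the largest `n` with `b ∈ J ^ n` (`⊤` if there is no largest one),
where `J` is the Jacobson radical of `B`, i.e. the maximal ideal if `B` is local. On a discrete
valuation ring this is the normalized valuation, with value `⊤` at `0`: see
`radicalOrder_eq_addVal`. -/
noncomputable def radicalOrder {B : Type*} [CommRing B] (b : B) : ℕ∞ :=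
  ⨆ (n : ℕ) (_ : b ∈ (Ideal.jacobson (⊥ : Ideal B)) ^ n), (n : ℕ∞)

theorem radicalOrder_eq_addVal {B : Type*} [CommRing B] [IsDomain B] [IsDiscreteValuationRing B]
    (b : B) : radicalOrder b = IsDiscreteValuationRing.addVal B b := by
  obtain ⟨p, hp⟩ := IsDiscreteValuationRing.exists_irreducible B
  have key : ∀ n : ℕ, b ∈ (Ideal.jacobson (⊥ : Ideal B)) ^ n ↔
      (n : ℕ∞) ≤ IsDiscreteValuationRing.addVal B b := by
    intro n
    rw [IsLocalRing.jacobson_eq_maximalIdeal _ bot_ne_top, hp.maximalIdeal_eq,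
      Ideal.span_singleton_pow, Ideal.mem_span_singleton, ← hp.addVal_pow n,
      IsDiscreteValuationRing.addVal_le_iff_dvd]
  unfold radicalOrder
  simp only [key]
  refine le_antisymm (iSup₂_le fun n hn => hn) ?_
  refine ENat.forall_natCast_le_iff_le.mp fun n hn => ?_
  exact le_iSup₂_of_le n hn le_rfl

/-- The normalized valuation `v(a)` of an element `a` of a ring `A`: the order of its image in the
integral closure of `A` in its total ring of fractions. It is used for `A = K[[X]] / P` with `P` a
branch of a curve; there the integral closure is a discrete valuation ring. -/
noncomputable def normalizedValue {A : Type*} [CommRing A] (a : A) : ℕ∞ :=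
  radicalOrder (algebraMap A (integralClosure A (FractionRing A)) a)

/-- An algebroid curve with `r` branches in `n`-space over `K`: a proper radical ideal `Q` of
`K[[X₁, …, Xₙ]]` whose distinct minimal primes `P 0, …, P (r - 1)` (the branches) all have a
quotient of Krull dimension one. -/
structure AlgebroidCurve (K : Type*) [Field K] (n r : ℕ) where
  Q : Ideal (MvPowerSeries (Fin n) K)
  P : Fin r → Ideal (MvPowerSeries (Fin n) K)
  ne_top : Q ≠ ⊤
  isRadical : Q.IsRadical
  injective_P : Function.Injective P
  range_P : Set.range P = Q.minimalPrimes
  dim_eq_one : ∀ i, ringKrullDim (MvPowerSeries (Fin n) K ⧸ P i) = 1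

namespace AlgebroidCurve

variable {K : Type*} [Field K] {n r : ℕ} (C : AlgebroidCurve K n r)

theorem Q_le_P (i : Fin r) : C.Q ≤ C.P i := by
  have h : C.P i ∈ C.Q.minimalPrimes := C.range_P ▸ Set.mem_range_self i
  exact h.1.2

/-- The local ring `𝒪 = K[[X₁, …, Xₙ]] / Q` of the curve. -/
abbrev LocalRing : Type _ := MvPowerSeries (Fin n) K ⧸ C.Q

instance isLocalRing : IsLocalRing C.LocalRing :=
  haveI : Nontrivial C.LocalRing := Ideal.Quotient.nontrivial_iff.mpr C.ne_top
  IsLocalRing.of_surjective' (Ideal.Quotient.mk C.Q) Ideal.Quotient.mk_surjective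

/-- The value vector `v(g) = (v₁(g), …, vᵣ(g))`, where `vᵢ(g)` is the normalized value of the image
of `g` in `𝒪ᵢ = K[[X₁, …, Xₙ]] / Pᵢ`. -/
noncomputable def value (g : C.LocalRing) : Fin r → ℕ∞ :=
  fun i => normalizedValue (Ideal.Quotient.factor (C.Q_le_P i) g)

/-- The set `Γ = v(𝒪)`, which is a semiring under componentwise minimum and addition. -/
def semiringOfValues : Set (Fin r → ℕ∞) := Set.range C.value

/-- `h` is a `k`-reduction of `g` modulo `G`. The `G`-products `∏ gⱼ ^ αⱼ` (including the empty
product `1`) are the elements of the multiplicative submonoid generated by `G`. -/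
def IsReductionAt (G : Set C.LocalRing) (g : C.LocalRing) (k : Fin r) (h : C.LocalRing) : Prop :=
  C.value g k ≠ ⊤ ∧
  (∃ c : K, ∃ p ∈ Submonoid.closure G, h = g - c • p) ∧
  (∀ i, C.value g i ≤ C.value h i) ∧ C.value g k < C.value h k

/-- `g` has a reduction modulo `G`. -/
def HasReduction (G : Set C.LocalRing) (g : C.LocalRing) : Prop :=
  ∃ k h, C.IsReductionAt G g k h

/-- `G` is a Standard Basis for `𝒪`: a nonempty finite set of nonzero elements of the maximal ideal
such that every nonzero element of `𝒪` has a reduction modulo `G`. -/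
structure IsStandardBasis (G : Set C.LocalRing) : Prop where
  nonempty : G.Nonempty
  finite : G.Finite
  mem_maximalIdeal : ∀ g ∈ G, g ∈ IsLocalRing.maximalIdeal C.LocalRing
  ne_zero : ∀ g ∈ G, g ≠ 0
  hasReduction : ∀ g : C.LocalRing, g ≠ 0 → C.HasReduction G g

/-- No element of `G` has a reduction modulo the other elements. -/
def IsMinimal (G : Set C.LocalRing) : Prop :=
  ∀ g ∈ G, ¬ C.HasReduction (G \ {g}) g

end AlgebroidCurve

section Values

variable {r : ℕ}

/-- `I_γ`, the set of indices of the finite coordinates of `γ`. -/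
def finiteIndices (γ : Fin r → ℕ∞) : Set (Fin r) := {i | γ i ≠ ⊤}

/-- `F_J(γ)`, as a subset of `Γ`. -/
def fiberSet (Γ : Set (Fin r → ℕ∞)) (J : Set (Fin r)) (γ : Fin r → ℕ∞) : Set (Fin r → ℕ∞) :=
  {α | α ∈ Γ ∧ (∀ i ∈ finiteIndices γ \ J, γ i < α i) ∧
    ∀ j, j ∉ finiteIndices γ \ J → α j = γ j}

/-- `γ` is an absolute (maximal) point of `Γ`: `F_J(γ)` is empty for every nontrivial subset `J` of
`I_γ` (nonempty and different from `I_γ`). -/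
def IsAbsolutePoint (Γ : Set (Fin r → ℕ∞)) (γ : Fin r → ℕ∞) : Prop :=
  γ ∈ Γ ∧ ∀ J : Set (Fin r), J.Nonempty → J ⊂ finiteIndices γ → fiberSet Γ J γ = ∅

/-- `γ` is an irreducible element of `Γ`. -/
def IsIrreducibleValue (Γ : Set (Fin r → ℕ∞)) (γ : Fin r → ℕ∞) : Prop :=
  γ ∈ Γ ∧ γ ≠ 0 ∧ ∀ α ∈ Γ, ∀ β ∈ Γ, γ = α + β → α = γ ∨ β = γ

/-- The set of irreducible absolute points of `Γ`. -/
def irreducibleAbsolutePoints (Γ : Set (Fin r → ℕ∞)) : Set (Fin r → ℕ∞) :=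
  {γ | IsIrreducibleValue Γ γ ∧ IsAbsolutePoint Γ γ}

/-- `V ⊆ Γ` is a system of generators of the semiring `Γ` (with operations minimum and addition):
every element of `Γ` is a componentwise minimum of `s` elements, `1 ≤ s ≤ r`, each of which is a
combination of elements of `V` with coefficients in `ℕ`. -/
def GeneratesSemiring (V Γ : Set (Fin r → ℕ∞)) : Prop :=
  V ⊆ Γ ∧ ∀ γ ∈ Γ, ∃ s : ℕ, 1 ≤ s ∧ s ≤ r ∧ ∃ τ : Fin s → (Fin r → ℕ∞),
    (∀ l, τ l ∈ AddSubmonoid.closure V) ∧ γ = ⨅ l, τ l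

end Values

/-! The argument separates the combinatorics of `Γ` from the algebra of the curve; the axioms of
`IsGoodSemigroup` are the interface.

Combinatorics. An absolute point is rigid: a value above it that meets it in one finite coordinate
equals it (`eq_of_le_of_apply_eq`). There are enough of them: through each coordinate of each value
passes an absolute point lying above that value (`exists_isAbsolutePoint`). Hence every value is a
minimum of `r` absolute points. Decomposing an absolute point, and enlarging the summands to
absolute points, reduces everything to irreducible absolute points by induction on one coordinate.
Conversely, rigidity forces an absolute point written as a minimum to be one of the terms, and
irreducibility forces that term to be a generator.

Standard bases. A reduction of `g` by `c • p` means exactly that `v(p)` lies above `v(g)` and meets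
it in a finite coordinate. If `v(g)` is an irreducible absolute point, rigidity gives `v(p) = v(g)`,
so a factor of `p` has this value; a standard basis therefore realizes all such points. An element
with any other value is reducible by the elements realizing them.

Algebra. For the axioms, each branch is made finite over some `K⟦X⟧`; its normalization is then
finite too, hence a discrete valuation ring with residue field `K` and nonzero conductor. Cancelling
leading terms gives `exists_lt`; conductors, together with elements vanishing on all branches but
one, give `exists_update_mem`. -/

/-- The combinatorial properties of the semiring of values of an algebroid curve. -/
structure IsGoodSemigroup {r : ℕ} (Γ : Set (Fin r → ℕ∞)) : Prop where
  zero_mem : 0 ∈ Γ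
  add_mem : ∀ α ∈ Γ, ∀ β ∈ Γ, α + β ∈ Γ
  top_mem : ⊤ ∈ Γ
  eq_zero : ∀ γ ∈ Γ, ∀ k, γ k = 0 → γ = 0
  exists_lt : ∀ α ∈ Γ, ∀ β ∈ Γ, ∀ k, α k = β k → α k ≠ ⊤ → ∃ δ ∈ Γ, α k < δ k ∧
    ∀ i, min (α i) (β i) ≤ δ i ∧ (α i ≠ β i → δ i = min (α i) (β i))
  exists_update_mem : ∃ N : ℕ, ∀ γ ∈ Γ, ∀ i, (N : ℕ∞) ≤ γ i → ∀ m : ℕ∞, (N : ℕ∞) ≤ m →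
    Function.update γ i m ∈ Γ

/-! ### Combinatorics of semirings of values. -/

namespace IsGoodSemigroup

variable {r : ℕ} {Γ : Set (Fin r → ℕ∞)}

theorem finite_setOf_lt_or_eq_top (N : ℕ) :
    {γ : Fin r → ℕ∞ | ∀ i, γ i < N ∨ γ i = ⊤}.Finite := by
  have h : {x : ℕ∞ | x < N ∨ x = ⊤}.Finite := by
    refine (((Set.finite_Iio N).image ((↑) : ℕ → ℕ∞)).union (Set.finite_singleton ⊤)).subset ?_
    rintro x (hx | hx)
    · left
      lift x to ℕ using (hx.trans_le le_top).ne
      exact ⟨x, by simpa using hx, rfl⟩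
    · exact Or.inr hx
  exact Set.Finite.pi' fun _ => h

theorem isAbsolutePoint_top (hΓ : IsGoodSemigroup Γ) : IsAbsolutePoint Γ ⊤ := by
  refine ⟨hΓ.top_mem, fun J hJ hJ' => ?_⟩
  obtain ⟨j, hj⟩ := hJ
  exact absurd rfl (hJ'.1 hj)

/-- A value above an absolute point which agrees with it in a finite coordinate is equal to it. -/
theorem eq_of_le_of_apply_eq {γ α : Fin r → ℕ∞} (hγ : IsAbsolutePoint Γ γ) (hα : α ∈ Γ)
    (hle : γ ≤ α) {k : Fin r} (hk : γ k ≠ ⊤) (hkα : α k = γ k) : α = γ := by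
  by_contra hne
  -- If `α ≠ γ`, the finite coordinates where they agree form a forbidden `J`.
  have hJ := hγ.2 {i | γ i ≠ ⊤ ∧ α i = γ i} ⟨k, hk, hkα⟩ ?_
  · refine (hJ ▸ Set.notMem_empty α) ⟨hα, ?_, ?_⟩
    · rintro i ⟨hi, hi'⟩
      exact lt_of_le_of_ne (hle i) fun h => hi' ⟨hi, h.symm⟩
    · intro j hj
      by_cases hjt : γ j = ⊤
      · have := hle j
        rw [hjt] at this ⊢
        exact top_le_iff.mp this
      · by_contra hj'
        exact hj ⟨hjt, fun h => hj' h.2⟩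
  · refine ⟨fun i hi => hi.1, fun h => hne ?_⟩
    funext i
    by_cases hi : γ i = ⊤
    · have := hle i
      rw [hi] at this ⊢
      exact top_le_iff.mp this
    · exact (h hi).2

/-- At a finite coordinate the infimum of finitely many terms is attained; rigidity identifies that
term with the absolute point. -/
theorem exists_eq_of_eq_iInf {γ : Fin r → ℕ∞} (hγ : IsAbsolutePoint Γ γ) {ι : Type*} [Finite ι]
    [Nonempty ι] {τ : ι → Fin r → ℕ∞} (hτ : ∀ l, τ l ∈ Γ) (h : γ = ⨅ l, τ l) :
    ∃ l, τ l = γ := by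
  have hle : ∀ l, γ ≤ τ l := fun l => h ▸ iInf_le τ l
  by_cases hI : ∃ k, γ k ≠ ⊤
  · obtain ⟨k, hk⟩ := hI
    obtain ⟨l, hl⟩ := exists_eq_ciInf_of_finite (f := fun l => τ l k)
    refine ⟨l, eq_of_le_of_apply_eq hγ (hτ l) (hle l) hk ?_⟩
    rw [hl, h, iInf_apply]
  · push Not at hI
    obtain ⟨l⟩ := ‹Nonempty ι›
    refine ⟨l, funext fun i => ?_⟩
    rw [hI i]
    exact top_le_iff.mp (hI i ▸ hle l i)

theorem closure_le (hΓ : IsGoodSemigroup Γ) {V : Set (Fin r → ℕ∞)} (hV : V ⊆ Γ)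
    {γ : Fin r → ℕ∞} (hγ : γ ∈ AddSubmonoid.closure V) : γ ∈ Γ := by
  induction hγ using AddSubmonoid.closure_induction with
  | mem x hx => exact hV hx
  | zero => exact hΓ.zero_mem
  | add x y _ _ hx hy => exact hΓ.add_mem x hx y hy

theorem mem_of_mem_closure (hΓ : IsGoodSemigroup Γ) {V : Set (Fin r → ℕ∞)} (hV : V ⊆ Γ)
    {γ : Fin r → ℕ∞} (hirr : IsIrreducibleValue Γ γ) (hγ : γ ∈ AddSubmonoid.closure V) :
    γ ∈ V := by
  suffices ∀ α ∈ AddSubmonoid.closure V, α = γ → γ ∈ V from this γ hγ rfl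
  intro α hα
  induction hα using AddSubmonoid.closure_induction with
  | mem x hx => exact fun h => h ▸ hx
  | zero => exact fun h => absurd h.symm hirr.2.1
  | add x y hx hy ihx ihy =>
    intro h
    exact (hirr.2.2 x (hΓ.closure_le hV hx) y (hΓ.closure_le hV hy) h.symm).elim ihx ihy

theorem irreducibleAbsolutePoints_subset (hΓ : IsGoodSemigroup Γ) {V : Set (Fin r → ℕ∞)}
    (hV : GeneratesSemiring V Γ) : irreducibleAbsolutePoints Γ ⊆ V := by
  rintro γ ⟨hirr, habs⟩
  obtain ⟨s, hs, -, τ, hτ, h⟩ := hV.2 γ habs.1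
  have : Nonempty (Fin s) := ⟨⟨0, hs⟩⟩
  obtain ⟨l, hl⟩ := exists_eq_of_eq_iInf habs (fun l => hΓ.closure_le hV.1 (hτ l)) h
  exact hΓ.mem_of_mem_closure hV.1 hirr (hl ▸ hτ l)

/-- Large coordinates of a value can be made infinite. -/
theorem exists_truncation_mem (hΓ : IsGoodSemigroup Γ) :
    ∃ N₀ : ℕ, ∀ N : ℕ, N₀ ≤ N → ∀ γ ∈ Γ, (fun i => if γ i < N then γ i else ⊤) ∈ Γ := by
  classical
  obtain ⟨N₀, h₀⟩ := hΓ.exists_update_mem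
  refine ⟨N₀, fun N hN γ hγ => ?_⟩
  suffices ∀ s : Finset (Fin r), (fun i => if i ∈ s ∧ ¬ γ i < N then ⊤ else γ i) ∈ Γ by
    convert this Finset.univ using 2 with i
    by_cases h : γ i < N <;> simp [h]
  intro s
  induction s using Finset.induction_on with
  | empty => simpa using hγ
  | insert a s ha ih =>
    by_cases h : γ a < N
    · convert ih using 2 with i
      by_cases hi : i = a
      · subst hi; simp [h]
      · simp [hi]
    · convert h₀ _ ih a ?_ ⊤ le_top using 1
      · funext i
        by_cases hi : i = a
        · subst hi; simp [not_lt.mp h]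
        · simp [hi]
      · simp only [ha, false_and, if_false]
        exact (by exact_mod_cast hN : (N₀ : ℕ∞) ≤ N).trans (not_lt.mp h)

/-- A maximal value above `γ` with the same `i`-th coordinate is absolute. Truncation leaves only
finitely many candidates, so a maximal one exists. -/
theorem exists_isAbsolutePoint (hΓ : IsGoodSemigroup Γ) {γ : Fin r → ℕ∞} (hγ : γ ∈ Γ)
    (i : Fin r) : ∃ τ, IsAbsolutePoint Γ τ ∧ γ ≤ τ ∧ τ i = γ i := by
  by_cases hi : γ i = ⊤
  · exact ⟨⊤, hΓ.isAbsolutePoint_top, le_top, hi.symm⟩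
  obtain ⟨N₀, hN₀⟩ := hΓ.exists_truncation_mem
  obtain ⟨c, hc⟩ := ENat.ne_top_iff_exists.mp hi
  -- The bound exceeds `γ i`, so truncation leaves coordinate `i` untouched.
  set N := max N₀ (c + 1) with hN
  have htr := hN₀ N (le_max_left _ _)
  have hcN : γ i < N := by
    rw [← hc]
    exact_mod_cast (Nat.lt_succ_self c).trans_le (le_max_right _ _)
  have hle : ∀ α : Fin r → ℕ∞, α ≤ fun i => if α i < N then α i else ⊤ := by
    intro α j
    dsimp only
    split_ifs <;> simp
  let S : Set (Fin r → ℕ∞) := {τ | τ ∈ Γ ∧ γ ≤ τ ∧ τ i = γ i ∧ ∀ j, τ j < N ∨ τ j = ⊤}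
  have hmemS : ∀ α ∈ Γ, γ ≤ α → α i = γ i → (fun i => if α i < N then α i else ⊤) ∈ S := by
    intro α hα hγα hαi
    refine ⟨htr α hα, hγα.trans (hle α), ?_, fun j => ?_⟩
    · simp [hαi, hcN]
    · dsimp only
      split_ifs with h <;> simp [h]
  have hfin : S.Finite := (finite_setOf_lt_or_eq_top N).subset fun τ hτ => hτ.2.2.2
  obtain ⟨τ, hτ⟩ := hfin.exists_maximal ⟨_, hmemS γ hγ le_rfl rfl⟩
  have hmax : ∀ α ∈ Γ, τ ≤ α → α i = γ i → α = τ := by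
    intro α hα hτα hαi
    have h1 := hmemS α hα (hτ.prop.2.1.trans hτα) hαi
    exact le_antisymm ((hle α).trans (hτ.2 h1 (hτα.trans (hle α)))) hτα
  refine ⟨τ, ⟨hτ.prop.1, fun J hJ hJI => ?_⟩, hτ.prop.2.1, hτ.prop.2.2.1⟩
  by_contra hne
  obtain ⟨α, hα, hlt, heq⟩ := Set.nonempty_iff_ne_empty.mpr hne
  have hτα : τ ≤ α := fun j => by
    by_cases hj : j ∈ finiteIndices τ \ J
    · exact (hlt j hj).le
    · exact (heq j hj).ge
  obtain ⟨m, hmI, hmJ⟩ := Set.exists_of_ssubset hJI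
  -- If `α` raises coordinate `i`, it cannot contradict maximality directly. Combining it with `τ`
  -- at a coordinate `j ∈ J` where they agree raises `j` and restores the value `τ i`.
  by_cases hiJ : i ∈ finiteIndices τ \ J
  · obtain ⟨j, hj⟩ := hJ
    have hjα : τ j = α j := (heq j fun h => h.2 hj).symm
    obtain ⟨δ, hδ, hδj, hδ'⟩ := hΓ.exists_lt τ hτ.prop.1 α hα j hjα (hJI.1 hj)
    have hτδ : τ ≤ δ := fun l => by simpa [hτα l] using (hδ' l).1
    have hδi : δ i = γ i := by
      rw [(hδ' i).2 (hlt i hiJ).ne, min_eq_left (hτα i), hτ.prop.2.2.1]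
    exact hδj.ne' (congrFun (hmax δ hδ hτδ hδi) j)
  · have := hmax α hα hτα ((heq i hiJ).trans hτ.prop.2.2.1)
    exact (hlt m ⟨hmI, hmJ⟩).ne' (congrFun this m)

/-- The summands of a finite-valued absolute point can be replaced by absolute points. -/
theorem exists_isAbsolutePoint_add (hΓ : IsGoodSemigroup Γ) {γ α β : Fin r → ℕ∞}
    (hγ : IsAbsolutePoint Γ γ) (hα : α ∈ Γ) (hβ : β ∈ Γ) (h : γ = α + β) {k : Fin r}
    (hk : γ k ≠ ⊤) :
    ∃ α' β', IsAbsolutePoint Γ α' ∧ IsAbsolutePoint Γ β' ∧ α' k = α k ∧ β' k = β k ∧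
      γ = α' + β' := by
  obtain ⟨α', hα', hle, hαk⟩ := hΓ.exists_isAbsolutePoint hα k
  obtain ⟨β', hβ', hle', hβk⟩ := hΓ.exists_isAbsolutePoint hβ k
  refine ⟨α', β', hα', hβ', hαk, hβk, (eq_of_le_of_apply_eq hγ
    (hΓ.add_mem _ hα'.1 _ hβ'.1) (h ▸ add_le_add hle hle') hk ?_).symm⟩
  rw [h, Pi.add_apply, Pi.add_apply, hαk, hβk]

/-- Strong induction on one finite coordinate: in a proper decomposition both summands are nonzero,
hence positive in every coordinate, so coordinate `k` drops in each. -/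
theorem mem_closure_of_apply_eq (hΓ : IsGoodSemigroup Γ) (k : Fin r) (n : ℕ) :
    ∀ γ, IsAbsolutePoint Γ γ → γ k = n →
      γ ∈ AddSubmonoid.closure (irreducibleAbsolutePoints Γ) := by
  induction n using Nat.strong_induction_on with
  | _ n ih =>
    intro γ hγ hn
    by_cases h0 : γ = 0
    · exact h0 ▸ AddSubmonoid.zero_mem _
    by_cases hirr : IsIrreducibleValue Γ γ
    · exact AddSubmonoid.subset_closure ⟨hirr, hγ⟩
    have : ∃ α ∈ Γ, ∃ β ∈ Γ, γ = α + β ∧ α ≠ γ ∧ β ≠ γ := by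
      by_contra! hcon
      refine hirr ⟨hγ.1, h0, fun α hα β hβ h => ?_⟩
      by_cases h' : α = γ
      · exact Or.inl h'
      · exact Or.inr (hcon α hα β hβ h h')
    obtain ⟨α, hα, β, hβ, h, hαγ, hβγ⟩ := this
    have hk : γ k ≠ ⊤ := by simp [hn]
    obtain ⟨α', β', hα', hβ', hαk, hβk, h'⟩ := hΓ.exists_isAbsolutePoint_add hγ hα hβ h hk
    have ha : α k ≠ 0 := fun h0 => hβγ (by rw [h, hΓ.eq_zero α hα k h0, zero_add])
    have hb : β k ≠ 0 := fun h0 => hαγ (by rw [h, hΓ.eq_zero β hβ k h0, add_zero])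
    have hsum : α k + β k = n := by rw [← hn, h, Pi.add_apply]
    have hat : α k ≠ ⊤ := fun ht => by simp [ht] at hsum
    have hbt : β k ≠ ⊤ := fun ht => by simp [ht] at hsum
    obtain ⟨a, ha'⟩ := ENat.ne_top_iff_exists.mp hat
    obtain ⟨b, hb'⟩ := ENat.ne_top_iff_exists.mp hbt
    rw [← ha'] at ha hsum hαk
    rw [← hb'] at hb hsum hβk
    norm_cast at ha hb hsum
    rw [h']
    exact AddSubmonoid.add_mem _ (ih a (by omega) α' hα' hαk) (ih b (by omega) β' hβ' hβk)

theorem update_top_add_update_top {i j : Fin r} (hij : i ≠ j) (a b : ℕ∞) :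
    Function.update (⊤ : Fin r → ℕ∞) i a + Function.update ⊤ j b = ⊤ := by
  funext l
  by_cases hi : l = i
  · subst hi; simp [Function.update_of_ne hij]
  · simp [hi]

/-- The point `⊤` has no finite coordinate to induct on. Having two branches makes it a sum of two
points, each finite in one coordinate only, and these are absolute points covered by the induction.
-/
theorem mem_closure_of_isAbsolutePoint (hΓ : IsGoodSemigroup Γ) (hr : 2 ≤ r) {γ : Fin r → ℕ∞}
    (hγ : IsAbsolutePoint Γ γ) : γ ∈ AddSubmonoid.closure (irreducibleAbsolutePoints Γ) := by
  by_cases hk : ∃ k, γ k ≠ ⊤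
  · obtain ⟨k, hk⟩ := hk
    obtain ⟨n, hn⟩ := ENat.ne_top_iff_exists.mp hk
    exact hΓ.mem_closure_of_apply_eq k n γ hγ hn.symm
  · push Not at hk
    obtain rfl : γ = ⊤ := funext hk
    obtain ⟨N, hN⟩ := hΓ.exists_update_mem
    have key : ∀ i, Function.update ⊤ i (N : ℕ∞) ∈
        AddSubmonoid.closure (irreducibleAbsolutePoints Γ) := by
      intro i
      obtain ⟨τ, hτ, hle, hi⟩ := hΓ.exists_isAbsolutePoint (hN ⊤ hΓ.top_mem i le_top N le_rfl) i
      have : τ = Function.update ⊤ i (N : ℕ∞) := by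
        funext l
        by_cases hl : l = i
        · subst hl; exact hi
        · have := hle l
          simp only [Function.update_of_ne hl, Pi.top_apply] at this ⊢
          exact top_le_iff.mp this
      rw [← this]
      exact hΓ.mem_closure_of_apply_eq i N τ hτ (by simpa using hi)
    have hij : (⟨0, by omega⟩ : Fin r) ≠ ⟨1, by omega⟩ := by simp
    rw [← update_top_add_update_top hij N N]
    exact AddSubmonoid.add_mem _ (key _) (key _)

theorem generatesSemiring (hΓ : IsGoodSemigroup Γ) (hr : 2 ≤ r) :
    GeneratesSemiring (irreducibleAbsolutePoints Γ) Γ := by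
  refine ⟨fun γ hγ => hγ.2.1, fun γ hγ => ⟨r, by omega, le_rfl, ?_⟩⟩
  choose τ hτ hle heq using fun i => hΓ.exists_isAbsolutePoint hγ i
  refine ⟨τ, fun l => hΓ.mem_closure_of_isAbsolutePoint hr (hτ l), le_antisymm (le_iInf hle) ?_⟩
  intro i
  rw [iInf_apply, ← heq i]
  exact iInf_le (fun l => τ l i) i

/-- A large finite coordinate could be raised to `⊤`, so by rigidity it is the only finite one; such
a point splits off a summand of the same shape. Finite coordinates are thus bounded. -/
theorem finite_irreducibleAbsolutePoints (hΓ : IsGoodSemigroup Γ) :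
    (irreducibleAbsolutePoints Γ).Finite := by
  obtain ⟨N₀, h₀⟩ := hΓ.exists_update_mem
  -- Positivity of `N` makes both `N` and `c - N` differ from `c` below.
  set N := N₀ + 1 with hN
  have hle : (N₀ : ℕ∞) ≤ N := by exact_mod_cast Nat.le_succ N₀
  refine (finite_setOf_lt_or_eq_top (N + N)).subset ?_
  rintro γ ⟨hirr, habs⟩ i
  by_contra! h
  obtain ⟨hi, hit⟩ := h
  obtain ⟨c, hc⟩ := ENat.ne_top_iff_exists.mp hit
  have hcN : N + N ≤ c := by rw [← hc] at hi; exact_mod_cast hi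
  have hNc : (N₀ : ℕ∞) ≤ γ i := by rw [← hc]; exact_mod_cast (by omega : N₀ ≤ c)
  have hothers : ∀ k, k ≠ i → γ k = ⊤ := by
    intro k hki
    by_contra hk
    have := eq_of_le_of_apply_eq habs (h₀ γ habs.1 i hNc ⊤ le_top)
      (le_update_iff.mpr ⟨le_top, fun _ _ => le_rfl⟩) hk (Function.update_of_ne hki _ _)
    exact hit (by rw [← this, Function.update_self])
  have hsum : γ = Function.update ⊤ i (N : ℕ∞) + Function.update ⊤ i ((c - N : ℕ) : ℕ∞) := by
    funext k
    by_cases hk : k = i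
    · subst hk
      simp only [Pi.add_apply, Function.update_self, ← hc]
      exact_mod_cast (by omega : c = N + (c - N))
    · simp [hothers k hk, hk]
  have hmem : ∀ m : ℕ, N ≤ m → Function.update (⊤ : Fin r → ℕ∞) i (m : ℕ∞) ∈ Γ := fun m hm =>
    h₀ ⊤ hΓ.top_mem i le_top m (hle.trans (by exact_mod_cast hm))
  rcases hirr.2.2 _ (hmem N le_rfl) _ (hmem (c - N) (by omega)) hsum with h | h
  · have := congrFun h i
    rw [Function.update_self, ← hc] at this
    norm_cast at this
    omega
  · have := congrFun h i
    rw [Function.update_self, ← hc] at this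
    norm_cast at this
    omega

end IsGoodSemigroup

/-! ### Modules over `K⟦X⟧`, controlled by their reduction modulo `X`. -/

section PowerSeriesModules

variable {K : Type*} [Field K] {M : Type*} [AddCommGroup M] [Module K M]
  [Module (PowerSeries K) M] [IsScalarTower K (PowerSeries K) M]

/-- A module over `K⟦X⟧` which is `X`-adically separated and finite-dimensional modulo `X` is
finitely generated. -/
theorem PowerSeries.moduleFinite_of_separated
    (hsep : ∀ x : M, (∀ n : ℕ, ∃ y : M, x = (PowerSeries.X : PowerSeries K) ^ n • y) → x = 0)
    {V : Submodule K M} (hV : V.FG)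
    (h : ∀ x : M, ∃ v ∈ V, ∃ y : M, x = v + (PowerSeries.X : PowerSeries K) • y) :
    Module.Finite (PowerSeries K) M := by
  obtain ⟨m, e, he⟩ := Submodule.fg_iff_exists_fin_generating_family.mp hV
  have h' : ∀ x : M, ∃ c : Fin m → K, ∃ y : M,
      x = ∑ j, c j • e j + (PowerSeries.X : PowerSeries K) • y := by
    intro x
    obtain ⟨v, hv, y, hy⟩ := h x
    rw [← he] at hv
    obtain ⟨c, hc⟩ := (Submodule.mem_span_range_iff_exists_fun K).mp hv
    exact ⟨c, y, by rw [hc, hy]⟩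
  choose c y hcy using h'
  have hmem : ∀ x : M, x ∈ Submodule.span (PowerSeries K) (Set.range e) := by
    intro x
    -- Iterating `x ↦ y x` produces the successive remainders; their coefficients `c` are the
    -- coefficients of the power series expressing `x`.
    have key : ∀ (n : ℕ) (x : M), ∃ z, x - ∑ j, PowerSeries.mk (fun k => c (y^[k] x) j) • e j =
        (PowerSeries.X : PowerSeries K) ^ n • z := by
      intro n
      induction n with
      | zero => exact fun x => ⟨_, by rw [pow_zero, one_smul]⟩
      | succ n ih =>
        intro x
        obtain ⟨z, hz⟩ := ih (y x)
        refine ⟨z, ?_⟩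
        have hmk : ∀ j, PowerSeries.mk (fun k => c (y^[k] x) j) =
            PowerSeries.C (c x j) + PowerSeries.X * PowerSeries.mk (fun k => c (y^[k] (y x)) j) := by
          intro j
          ext k
          cases k with
          | zero => simp
          | succ k => simp [PowerSeries.coeff_succ_X_mul]
        have hC : ∀ (a : K) (u : M), (PowerSeries.C a : PowerSeries K) • u = a • u := by
          intro a u
          rw [PowerSeries.C_eq_algebraMap, algebraMap_smul]
        rw [pow_succ', mul_smul, ← hz, smul_sub]
        simp_rw [hmk, add_smul, hC, mul_smul, Finset.sum_add_distrib, Finset.smul_sum]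
        rw [sub_add_eq_sub_sub, sub_eq_of_eq_add' (hcy x)]
    have := hsep _ (fun n => key n x)
    rw [sub_eq_zero.mp this]
    exact Submodule.sum_mem _ fun j _ =>
      Submodule.smul_mem _ _ (Submodule.subset_span (Set.mem_range_self j))
  refine ⟨Submodule.fg_def.mpr ⟨_, Set.finite_range e, ?_⟩⟩
  exact (Submodule.eq_top_iff'.mpr hmem)

/-- Reducing a relation modulo `X` kills the constant coefficients; torsion-freeness cancels `X`,
and repetition kills all coefficients. -/
theorem PowerSeries.linearIndependent_of_mod_X {ι : Type*} [Fintype ι] {v : ι → M}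
    (htf : ∀ x : M, (PowerSeries.X : PowerSeries K) • x = 0 → x = 0)
    (h : ∀ c : ι → K, (∃ y : M, ∑ i, c i • v i = (PowerSeries.X : PowerSeries K) • y) →
      ∀ i, c i = 0) : LinearIndependent (PowerSeries K) v := by
  rw [Fintype.linearIndependent_iff]
  intro f hf
  have hdvd : ∀ g : ι → PowerSeries K, ∑ i, g i • v i = 0 → ∃ g' : ι → PowerSeries K,
      ∑ i, g' i • v i = 0 ∧ ∀ i, g i = PowerSeries.X * g' i := by
    intro g hg
    have hdec : ∀ i, g i = PowerSeries.X * PowerSeries.mk (fun p => PowerSeries.coeff (p + 1) (g i))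
        + algebraMap K _ (PowerSeries.constantCoeff (g i)) := fun i =>
      PowerSeries.eq_X_mul_shift_add_const (g i)
    set g' : ι → PowerSeries K := fun i => PowerSeries.mk (fun p => PowerSeries.coeff (p + 1) (g i))
    have hsum : (PowerSeries.X : PowerSeries K) • ∑ i, g' i • v i +
        ∑ i, PowerSeries.constantCoeff (g i) • v i = 0 := by
      rw [← hg, Finset.smul_sum, ← Finset.sum_add_distrib]
      refine Finset.sum_congr rfl fun i _ => ?_
      conv_rhs => rw [hdec i]
      rw [add_smul, mul_smul, algebraMap_smul]
    have hc := h (fun i => PowerSeries.constantCoeff (g i))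
      ⟨-∑ i, g' i • v i, by rw [smul_neg]; exact eq_neg_of_add_eq_zero_right hsum⟩
    refine ⟨g', htf _ ?_, fun i => ?_⟩
    · simpa [hc] using hsum
    · have := hdec i
      simpa [hc] using this
  have hcoeff : ∀ (n : ℕ) (g : ι → PowerSeries K), ∑ i, g i • v i = 0 →
      ∀ i, PowerSeries.coeff n (g i) = 0 := by
    intro n
    induction n with
    | zero =>
      intro g hg i
      obtain ⟨g', -, h'⟩ := hdvd g hg
      simp [h' i]
    | succ n ih =>
      intro g hg i
      obtain ⟨g', hg', h'⟩ := hdvd g hg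
      rw [h' i, PowerSeries.coeff_succ_X_mul, ih g' hg' i]
  exact fun i => PowerSeries.ext fun n => by simpa using hcoeff n f hf i

/-- A torsion-free `X`-adically separated `K⟦X⟧`-module of finite rank is finitely generated. -/
theorem PowerSeries.moduleFinite_of_rank_le
    (hsep : ∀ x : M, (∀ n : ℕ, ∃ y : M, x = (PowerSeries.X : PowerSeries K) ^ n • y) → x = 0)
    (htf : ∀ x : M, (PowerSeries.X : PowerSeries K) • x = 0 → x = 0) (N : ℕ)
    (hN : ∀ (s : Finset M), LinearIndependent (PowerSeries K) (fun x : s => (x : M)) → s.card ≤ N) :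
    Module.Finite (PowerSeries K) M := by
  classical
  let W : Submodule K M :=
    (LinearMap.range (LinearMap.lsmul (PowerSeries K) M PowerSeries.X)).restrictScalars K
  have hW : ∀ x, x ∈ W ↔ ∃ y : M, x = (PowerSeries.X : PowerSeries K) • y := fun x =>
    exists_congr fun y => eq_comm
  let q := W.mkQ
  have hq : Function.Surjective q := W.mkQ_surjective
  -- Lifts of a `K`-independent family of `M / XM` are independent over `K⟦X⟧`, so the rank bound
  -- applies to them.
  have hrank : Module.rank K (M ⧸ W) ≤ N := by
    refine rank_le fun s hs => ?_
    let v : s → M := fun i => Function.surjInv hq i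
    have hv : ∀ i, q (v i) = i := fun i => Function.surjInv_eq hq i
    have hli : LinearIndependent (PowerSeries K) v := by
      refine PowerSeries.linearIndependent_of_mod_X htf fun c hc => ?_
      rw [← hW, ← Submodule.Quotient.mk_eq_zero, ← Submodule.mkQ_apply, map_sum] at hc
      refine Fintype.linearIndependent_iff.mp hs c ?_
      rw [← hc]
      exact Finset.sum_congr rfl fun i _ => by rw [map_smul, hv]
    have := hN (Finset.univ.image v) ?_
    · rwa [Finset.card_image_of_injective _ hli.injective, Finset.card_univ,
        Fintype.card_coe] at this
    · have := hli.linearIndepOn_id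
      rw [← Set.image_univ, ← Finset.coe_univ, ← Finset.coe_image] at this
      exact this
  have : Module.Finite K (M ⧸ W) :=
    Module.rank_lt_aleph0_iff.mp (hrank.trans_lt (Cardinal.natCast_lt_aleph0))
  obtain ⟨m, e, he⟩ := Submodule.fg_iff_exists_fin_generating_family.mp this.fg_top
  refine PowerSeries.moduleFinite_of_separated hsep
    (V := Submodule.span K (Set.range fun j => Function.surjInv hq (e j)))
    (Submodule.fg_span (Set.finite_range _)) fun x => ?_
  have hx : q x ∈ Submodule.span K (Set.range e) := he ▸ Submodule.mem_top
  obtain ⟨c, hc⟩ := (Submodule.mem_span_range_iff_exists_fun K).mp hx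
  refine ⟨∑ j, c j • Function.surjInv hq (e j), Submodule.sum_mem _ fun j _ =>
    Submodule.smul_mem _ _ (Submodule.subset_span ⟨j, rfl⟩), ?_⟩
  have : x - ∑ j, c j • Function.surjInv hq (e j) ∈ W := by
    rw [← Submodule.Quotient.mk_eq_zero, ← Submodule.mkQ_apply, map_sub, map_sum, ← hc, sub_eq_zero]
    exact Finset.sum_congr rfl fun j _ => by rw [map_smul, Function.surjInv_eq hq]
  obtain ⟨y, hy⟩ := (hW _).mp this
  exact ⟨y, by rw [← hy]; abel⟩

end PowerSeriesModules

/-! ### Completeness and lifting of idempotents. -/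

/-- A finite module over an adically complete ring is precomplete. -/
theorem IsPrecomplete.of_finite {R M : Type*} [CommRing R] [AddCommGroup M] [Module R M]
    (I : Ideal R) [IsPrecomplete I R] [Module.Finite R M] : IsPrecomplete I M := by
  obtain ⟨m, e, he⟩ := Submodule.fg_iff_exists_fin_generating_family.mp
    (Module.Finite.fg_top (R := R) (M := M))
  have hpow : ∀ (n : ℕ) (x : M), x ∈ (I ^ n • ⊤ : Submodule R M) →
      ∃ c : Fin m → R, (∀ j, c j ∈ I ^ n) ∧ x = ∑ j, c j • e j := by
    intro n x hx
    rw [← he, Submodule.mem_ideal_smul_span_iff_exists_sum] at hx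
    obtain ⟨a, ha, hx⟩ := hx
    refine ⟨a, ha, ?_⟩
    rw [← hx, Finsupp.sum_fintype]
    simp
  refine ⟨fun f hf => ?_⟩
  have hstep : ∀ n, f (n + 1) - f n ∈ (I ^ n • ⊤ : Submodule R M) := fun n =>
    (SModEq.sub_mem).mp (hf n.le_succ).symm
  choose c hcI hc using fun n => hpow n _ (hstep n)
  obtain ⟨c₀, -, hc₀⟩ := hpow 0 (f 0) (by simp)
  have hlim : ∀ j, ∃ L : R, ∀ n, ∑ k ∈ Finset.range n, c k j ≡ L [SMOD (I ^ n • ⊤ : Ideal R)] := by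
    intro j
    refine IsPrecomplete.prec' (I := I) (fun n => ∑ k ∈ Finset.range n, c k j) ?_
    intro a b hab
    rw [SModEq.comm, SModEq.sub_mem, ← Finset.sum_sdiff (Finset.range_mono hab), add_sub_cancel_right]
    refine Submodule.sum_mem _ fun k hk => ?_
    simp only [Finset.mem_sdiff, Finset.mem_range, not_lt] at hk
    rw [smul_eq_mul, Ideal.mul_top]
    exact Ideal.pow_le_pow_right hk.2 (hcI k j)
  choose L hL using hlim
  refine ⟨∑ j, (c₀ j + L j) • e j, fun n => ?_⟩
  have hfn : f n = ∑ j, (c₀ j + ∑ k ∈ Finset.range n, c k j) • e j := by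
    induction n with
    | zero => simpa using hc₀
    | succ n ih =>
      rw [← sub_add_cancel (f (n + 1)) (f n), hc n, ih, ← Finset.sum_add_distrib]
      refine Finset.sum_congr rfl fun j _ => ?_
      rw [← add_smul, Finset.sum_range_succ]
      ring_nf
  rw [hfn, SModEq.sub_mem, ← Finset.sum_sub_distrib]
  refine Submodule.sum_mem _ fun j _ => ?_
  rw [← sub_smul, add_sub_add_left_eq_sub]
  refine Submodule.smul_mem_smul ?_ Submodule.mem_top
  have := SModEq.sub_mem.mp (hL j n)
  rwa [smul_eq_mul, Ideal.mul_top] at this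

/-- A domain which is adically complete for an ideal with Artinian quotient is local. -/
theorem IsLocalRing.of_isAdicComplete_of_isArtinianRing {B : Type*} [CommRing B] [IsDomain B]
    (I : Ideal B) [IsAdicComplete I B] [IsArtinianRing (B ⧸ I)] : IsLocalRing B := by
  have hjac : I ≤ Ideal.jacobson ⊥ := IsAdicComplete.le_jacobson_bot I
  have hloc := isLocalHom_of_le_jacobson_bot I hjac
  refine IsLocalRing.of_isUnit_or_isUnit_one_sub_self fun x => ?_
  set π := Ideal.Quotient.mk I
  -- The powers of `x` stabilize modulo `I`, which makes `x ^ n * y ^ n` idempotent there.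
  obtain ⟨n, y, hy⟩ := IsArtinian.exists_pow_succ_smul_dvd (π x) (1 : B ⧸ I)
  obtain ⟨y, rfl⟩ := Ideal.Quotient.mk_surjective y
  simp only [smul_eq_mul, mul_one, Nat.succ_eq_add_one] at hy
  have hiter : ∀ k, π x ^ (n + k) * π y ^ k = π x ^ n := by
    intro k
    induction k with
    | zero => simp
    | succ k ih =>
      calc π x ^ (n + (k + 1)) * π y ^ (k + 1)
          = (π x ^ (n + 1) * π y) * (π x ^ k * π y ^ k) := by ring
        _ = π x ^ (n + k) * π y ^ k := by rw [hy]; ring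
        _ = π x ^ n := ih
  set e := x ^ n * y ^ n
  have he : π e * π e = π e := by
    simp only [e, map_mul, map_pow]
    linear_combination π y ^ n * hiter n
  have hxe : π x ^ n * π e = π x ^ n := by
    simp only [e, map_mul, map_pow]
    linear_combination hiter n
  -- Hensel lifts the idempotent as a root of `X ^ 2 - X`: the derivative `2 * e - 1` squares to `1`
  -- modulo `I`. In a domain the lift is `0` or `1`, so `x` is nilpotent or a unit modulo `I`.
  obtain ⟨a, ha, hae⟩ := HenselianRing.is_henselian (I := I)
    (Polynomial.X ^ 2 - Polynomial.X : Polynomial B)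
    (by
      refine Polynomial.monic_X_pow_sub ?_
      rw [Polynomial.degree_X]; norm_num) e
    (by
      rw [← Ideal.Quotient.eq_zero_iff_mem]
      simp [pow_two, he, π])
    (by
      refine IsUnit.of_mul_eq_one (π (2 * e - 1)) ?_
      simp only [Polynomial.derivative_X_pow, Polynomial.derivative_X,
        Polynomial.eval_sub, Polynomial.eval_mul, Polynomial.eval_X, Polynomial.eval_one,
        Polynomial.eval_ofNat, map_sub, map_mul, map_one, Nat.cast_ofNat,
        Nat.add_one_sub_one, pow_one, map_ofNat]
      linear_combination 4 * he)
  have ha' : a * (a - 1) = 0 := by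
    have := ha
    simp only [Polynomial.IsRoot, Polynomial.eval_sub, Polynomial.eval_pow, Polynomial.eval_X] at this
    linear_combination this
  have hπ : π a = π e := Ideal.Quotient.eq.mpr hae
  rcases mul_eq_zero.mp ha' with h | h
  · right
    have hnil : π x ^ n = 0 := by rw [← hxe, ← hπ, h, map_zero, mul_zero]
    refine hloc.map_nonunit _ ?_
    rw [map_sub, map_one]
    exact IsNilpotent.isUnit_one_sub ⟨n, hnil⟩
  · left
    refine hloc.map_nonunit _ ?_
    have h1 : π x ^ n * π y ^ n = 1 := by
      rw [← map_pow, ← map_pow, ← map_mul, show x ^ n * y ^ n = e from rfl, ← hπ,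
        sub_eq_zero.mp h, map_one]
    rcases Nat.eq_zero_or_pos n with rfl | hn
    · exact IsUnit.of_mul_eq_one (π y) (by simpa using hy)
    · exact (isUnit_pow_iff hn.ne').mp (IsUnit.of_mul_eq_one _ h1)

/-! ### Domains over `K⟦X⟧`. -/

theorem PowerSeries.algebraMap_injective_of_ne_zero {K A : Type*} [Field K] [CommRing A] [IsDomain A]
    [Algebra (PowerSeries K) A]
    (ht0 : algebraMap (PowerSeries K) A PowerSeries.X ≠ 0) :
    Function.Injective (algebraMap (PowerSeries K) A) := by
  rw [injective_iff_map_eq_zero]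
  intro f hf
  by_contra hf0
  obtain ⟨n, u, hu⟩ := IsDiscreteValuationRing.eq_unit_mul_pow_irreducible hf0
    (PowerSeries.X_irreducible (R := K))
  rw [hu, map_mul, map_pow] at hf
  exact mul_ne_zero ((u.isUnit.map _).ne_zero) (pow_ne_zero n ht0) hf

theorem PowerSeries.not_isUnit_algebraMap_X {K B : Type*} [Field K] [CommRing B]
    [Algebra (PowerSeries K) B] [Algebra.IsIntegral (PowerSeries K) B]
    [FaithfulSMul (PowerSeries K) B] :
    ¬ IsUnit (algebraMap (PowerSeries K) B PowerSeries.X) := by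
  intro h
  have := Algebra.IsIntegral.isLocalHom (R := PowerSeries K) (S := B)
  exact PowerSeries.X_irreducible.not_isUnit (this.map_nonunit _ h)

theorem IsLocalRing.exists_fg_mod_maximalIdeal_pow {K A : Type*} [Field K] [CommRing A] [Algebra K A]
    [IsLocalRing A]
    (hfg : (IsLocalRing.maximalIdeal A).FG)
    (hres : ∀ a : A, ∃ c : K, a - algebraMap K A c ∈ IsLocalRing.maximalIdeal A) (n : ℕ) :
    ∃ V : Submodule K A, V.FG ∧ ∀ a : A, ∃ v ∈ V, a - v ∈ IsLocalRing.maximalIdeal A ^ n := by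
  induction n with
  | zero => exact ⟨⊥, Submodule.fg_bot, fun a => ⟨0, zero_mem _, by simp⟩⟩
  | succ n ih =>
    obtain ⟨V, hV, h⟩ := ih
    obtain ⟨m, g, hg⟩ := Submodule.fg_iff_exists_fin_generating_family.mp (hfg.pow (n := n))
    refine ⟨V ⊔ Submodule.span K (Set.range g),
      hV.sup (Submodule.fg_span (Set.finite_range g)), fun a => ?_⟩
    obtain ⟨v, hv, hav⟩ := h a
    rw [← hg] at hav
    obtain ⟨x, hx⟩ := (Submodule.mem_span_range_iff_exists_fun A).mp hav
    choose c hc using fun j => hres (x j)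
    refine ⟨v + ∑ j, c j • g j, Submodule.add_mem_sup hv (Submodule.sum_mem _ fun j _ =>
      Submodule.smul_mem _ _ (Submodule.subset_span ⟨j, rfl⟩)), ?_⟩
    rw [← sub_sub, ← hx, ← Finset.sum_sub_distrib, pow_succ']
    refine Ideal.sum_mem _ fun j _ => ?_
    rw [smul_eq_mul, Algebra.smul_def, ← sub_mul]
    exact Ideal.mul_mem_mul (hc j) (hg ▸ Submodule.subset_span ⟨j, rfl⟩)

/-- A nonzero integral element divides a nonzero power series, that is, a unit times some `X ^ n`.
Divisibility by `X ^ (n + 1)` would then make `X` a unit. -/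
theorem PowerSeries.eq_zero_of_forall_X_pow_dvd {K B : Type*} [Field K] [CommRing B] [IsDomain B]
    [Algebra (PowerSeries K) B] [Algebra.IsIntegral (PowerSeries K) B]
    [FaithfulSMul (PowerSeries K) B] (x : B)
    (hx : ∀ n : ℕ, ∃ y : B, x = (PowerSeries.X : PowerSeries K) ^ n • y) : x = 0 := by
  by_contra hx0
  obtain ⟨f, hf0, z, hz⟩ := (Algebra.IsIntegral.isIntegral (R := PowerSeries K) x).isAlgebraic
    |>.exists_nonzero_dvd (mem_nonZeroDivisors_of_ne_zero hx0)
  obtain ⟨n, u, hu⟩ := IsDiscreteValuationRing.eq_unit_mul_pow_irreducible hf0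
    (PowerSeries.X_irreducible (R := K))
  obtain ⟨y, hy⟩ := hx (n + 1)
  rw [Algebra.smul_def, map_pow] at hy
  rw [hu, map_mul, map_pow, hy] at hz
  have ht0 : algebraMap (PowerSeries K) B PowerSeries.X ≠ 0 := by
    simp
  set t := algebraMap (PowerSeries K) B PowerSeries.X
  have h1 : t ^ n * (t * (y * z) - algebraMap _ B (u : PowerSeries K)) = 0 := by
    linear_combination -hz
  have h2 := sub_eq_zero.mp ((mul_eq_zero.mp h1).resolve_left (pow_ne_zero _ ht0))
  exact PowerSeries.not_isUnit_algebraMap_X (K := K) (B := B)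
    (isUnit_of_mul_isUnit_left (h2 ▸ u.isUnit.map _))

/-! ### One-dimensional local domains as finite `K⟦X⟧`-modules. -/

section Finiteness

variable {K : Type*} [Field K] {A : Type*} [CommRing A] [IsDomain A] [Algebra K A]
  [Algebra (PowerSeries K) A] [IsScalarTower K (PowerSeries K) A]

/-- In a one-dimensional local domain, every nonzero element divides a power of any non-unit. -/
theorem IsLocalRing.exists_dvd_pow [IsLocalRing A] [Ring.KrullDimLE 1 A] {x t : A} (hx : x ≠ 0)
    (ht : t ∈ IsLocalRing.maximalIdeal A) : ∃ n : ℕ, x ∣ t ^ n := by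
  have : t ∈ (Ideal.span {x}).radical := by
    rw [Ideal.radical_eq_sInf, Submodule.mem_sInf]
    rintro p ⟨hxp, hp⟩
    have hpb : p ≠ ⊥ := fun h => hx (by simpa [h] using hxp)
    rwa [IsLocalRing.eq_maximalIdeal (hp.isMaximal_of_ne_bot hpb)]
  obtain ⟨n, hn⟩ := this
  exact ⟨n, Ideal.mem_span_singleton.mp hn⟩

theorem IsLocalRing.exists_maximalIdeal_pow_le [IsLocalRing A] [Ring.KrullDimLE 1 A] {x : A}
    (hfg : (IsLocalRing.maximalIdeal A).FG) (hx : x ≠ 0) :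
    ∃ n : ℕ, IsLocalRing.maximalIdeal A ^ n ≤ Ideal.span {x} := by
  refine Ideal.exists_pow_le_of_le_radical_of_fg (fun t ht => ?_) hfg
  obtain ⟨n, hn⟩ := IsLocalRing.exists_dvd_pow hx ht
  exact ⟨n, Ideal.mem_span_singleton.mpr hn⟩

/-- Let `t` be the image of `X`. Some power of the maximal ideal lies in `(t)`, so `A / t` is
finite-dimensional over `K`; and `A` is `t`-adically separated because every nonzero element divides
a power of `t`. -/
theorem PowerSeries.moduleFinite_of_krullDimLE_one [IsLocalRing A] [Ring.KrullDimLE 1 A]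
    (hfg : (IsLocalRing.maximalIdeal A).FG)
    (hres : ∀ a : A, ∃ c : K, a - algebraMap K A c ∈ IsLocalRing.maximalIdeal A)
    (ht : algebraMap (PowerSeries K) A PowerSeries.X ∈ IsLocalRing.maximalIdeal A)
    (ht0 : algebraMap (PowerSeries K) A PowerSeries.X ≠ 0) : Module.Finite (PowerSeries K) A := by
  obtain ⟨n, hn⟩ := IsLocalRing.exists_maximalIdeal_pow_le hfg ht0
  obtain ⟨V, hV, h⟩ := IsLocalRing.exists_fg_mod_maximalIdeal_pow hfg hres n
  refine PowerSeries.moduleFinite_of_separated (fun x hx => ?_) hV fun x => ?_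
  · by_contra hx0
    obtain ⟨m, z, hz⟩ := IsLocalRing.exists_dvd_pow hx0 ht
    obtain ⟨y, hy⟩ := hx (m + 1)
    rw [Algebra.smul_def, map_pow] at hy
    set t := algebraMap (PowerSeries K) A PowerSeries.X
    have h1 : t ^ m * (t * y * z - 1) = 0 := by
      rw [hy] at hz
      linear_combination -hz
    have h2 : t * (y * z) = 1 := by
      rw [← mul_assoc]
      exact sub_eq_zero.mp ((mul_eq_zero.mp h1).resolve_left (pow_ne_zero _ ht0))
    exact (IsLocalRing.mem_maximalIdeal _).mp ht (IsUnit.of_mul_eq_one _ h2)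
  · obtain ⟨v, hv, hxv⟩ := h x
    obtain ⟨y, hy⟩ := Ideal.mem_span_singleton.mp (hn hxv)
    exact ⟨v, hv, y, by rw [Algebra.smul_def, ← hy]; ring⟩

end Finiteness

/-! ### The normalization is a discrete valuation ring. -/

section IntegralExtension

variable {K : Type*} [Field K] {B : Type*} [CommRing B] [IsDomain B] [Algebra K B]
  [Algebra (PowerSeries K) B] [IsScalarTower K (PowerSeries K) B]

/-- A birational integral extension of a finite `K⟦X⟧`-algebra is finite over `K⟦X⟧`. -/
theorem PowerSeries.moduleFinite_of_birational {A : Type*} [CommRing A]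
    [Algebra (PowerSeries K) A] [Algebra A B] [IsScalarTower (PowerSeries K) A B] [FaithfulSMul A B]
    [Module.Finite (PowerSeries K) A] [Algebra.IsIntegral (PowerSeries K) B]
    [FaithfulSMul (PowerSeries K) B]
    (hden : ∀ s : Finset B, ∃ a : A, a ≠ 0 ∧ ∀ b ∈ s, ∃ a', algebraMap A B a' = a • b) :
    Module.Finite (PowerSeries K) B := by
  have ht0 : algebraMap (PowerSeries K) B PowerSeries.X ≠ 0 := by
    simp
  refine PowerSeries.moduleFinite_of_rank_le PowerSeries.eq_zero_of_forall_X_pow_dvd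
    (fun x hx => ?_) (Module.finrank (PowerSeries K) A) fun s hs => ?_
  · rw [Algebra.smul_def] at hx
    exact (mul_eq_zero.mp hx).resolve_left ht0
  -- A common denominator carries an independent family into `A`, whose rank bounds its size.
  · obtain ⟨a, ha, h⟩ := hden s
    choose v hv using fun b : s => h b b.2
    have hli : LinearIndependent (PowerSeries K) v := by
      rw [Fintype.linearIndependent_iff] at hs ⊢
      intro f hf
      refine hs f ?_
      have h0 : algebraMap A B a * ∑ i, f i • (i : B) = 0 := by
        rw [← map_zero (algebraMap A B), ← hf, map_sum, Finset.mul_sum]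
        refine Finset.sum_congr rfl fun i _ => ?_
        rw [Algebra.smul_def, Algebra.smul_def, map_mul, ← IsScalarTower.algebraMap_apply, hv,
          Algebra.smul_def]
        ring
      exact (mul_eq_zero.mp h0).resolve_left
        (by simpa using (FaithfulSMul.algebraMap_injective A B).ne ha)
    have : Nontrivial A := ⟨a, 0, ha⟩
    simpa using hli.fintype_card_le_finrank

theorem PowerSeries.moduleFinite_of_X_smul_eq_zero {M : Type*} [AddCommGroup M] [Module K M]
    [Module (PowerSeries K) M] [IsScalarTower K (PowerSeries K) M] [Module.Finite (PowerSeries K) M]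
    (h : ∀ x : M, (PowerSeries.X : PowerSeries K) • x = 0) : Module.Finite K M := by
  obtain ⟨m, e, he⟩ := Submodule.fg_iff_exists_fin_generating_family.mp
    (Module.Finite.fg_top (R := PowerSeries K) (M := M))
  refine ⟨Submodule.fg_iff_exists_fin_generating_family.mpr ⟨m, e, ?_⟩⟩
  refine Submodule.eq_top_iff'.mpr fun x => ?_
  obtain ⟨c, rfl⟩ := (Submodule.mem_span_range_iff_exists_fun (PowerSeries K)).mp
    (he ▸ Submodule.mem_top : x ∈ Submodule.span (PowerSeries K) (Set.range e))
  refine Submodule.sum_mem _ fun j _ => ?_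
  have : c j • e j = PowerSeries.constantCoeff (c j) • e j := by
    conv_lhs => rw [PowerSeries.eq_X_mul_shift_add_const (c j), add_smul, mul_smul, h, zero_add,
      PowerSeries.C_eq_algebraMap, algebraMap_smul]
  rw [this]
  exact Submodule.smul_mem _ _ (Submodule.subset_span ⟨j, rfl⟩)

/-- Finiteness over `K⟦X⟧` makes `B` complete for `X`, with a quotient `B / XB` that is finite over
`K` and hence Artinian. -/
theorem PowerSeries.isLocalRing_of_moduleFinite [Module.Finite (PowerSeries K) B]
    [FaithfulSMul (PowerSeries K) B] : IsLocalRing B := by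
  let I : Ideal (PowerSeries K) := Ideal.span {PowerSeries.X}
  have hmap : I.map (algebraMap (PowerSeries K) B) =
      Ideal.span {algebraMap (PowerSeries K) B PowerSeries.X} := by
    rw [Ideal.map_span, Set.image_singleton]
  have : IsHausdorff I B := by
    refine ⟨fun x hx => PowerSeries.eq_zero_of_forall_X_pow_dvd (K := K) x fun n => ?_⟩
    have := SModEq.zero.mp (hx n)
    rw [Ideal.span_singleton_pow, Submodule.ideal_span_singleton_smul,
      Submodule.mem_smul_pointwise_iff_exists] at this
    obtain ⟨y, -, hy⟩ := this
    exact ⟨y, hy.symm⟩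
  have : IsPrecomplete I B := IsPrecomplete.of_finite I
  have : IsAdicComplete I B := ⟨⟩
  have : IsAdicComplete (I.map (algebraMap (PowerSeries K) B)) B :=
    (IsAdicComplete.map_algebraMap_iff I B).mpr this
  have : Module.Finite K (B ⧸ I.map (algebraMap (PowerSeries K) B)) := by
    refine PowerSeries.moduleFinite_of_X_smul_eq_zero fun x => ?_
    obtain ⟨b, rfl⟩ := Ideal.Quotient.mk_surjective x
    rw [← Ideal.Quotient.mk_eq_mk, ← Submodule.Quotient.mk_smul, Submodule.Quotient.mk_eq_zero, hmap,
      Algebra.smul_def]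
    exact Ideal.mul_mem_right _ _ (Ideal.mem_span_singleton_self _)
  have : IsArtinianRing (B ⧸ I.map (algebraMap (PowerSeries K) B)) :=
    IsArtinianRing.of_finite K _
  exact IsLocalRing.of_isAdicComplete_of_isArtinianRing (I.map (algebraMap (PowerSeries K) B))

theorem PowerSeries.isDiscreteValuationRing_of_moduleFinite [Module.Finite (PowerSeries K) B]
    [FaithfulSMul (PowerSeries K) B] [IsIntegrallyClosed B] : IsDiscreteValuationRing B := by
  have := PowerSeries.isLocalRing_of_moduleFinite (K := K) (B := B)
  have : IsNoetherianRing B := IsNoetherianRing.of_finite (PowerSeries K) B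
  have : Ring.DimensionLEOne B := Ring.DimensionLEOne.of_isIntegral (PowerSeries K) B
  have hf : ¬ IsField B := by
    intro hf
    refine PowerSeries.not_isUnit_algebraMap_X (K := K) (B := B) ?_
    let := hf.toField
    have := (FaithfulSMul.algebraMap_injective (PowerSeries K) B).ne PowerSeries.X_ne_zero
    rw [map_zero] at this
    obtain ⟨b, hb⟩ := hf.mul_inv_cancel this
    exact IsUnit.of_mul_eq_one _ hb
  have : IsDedekindRing B := ⟨⟩
  have hD : IsDedekindDomain B := ⟨⟩
  exact ((IsDiscreteValuationRing.TFAE B hf).out 0 2).mpr hD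

end IntegralExtension

/-- `X` kills the residue field, which is therefore finite over `K`. Here algebraic closedness
enters: the residue field is `K` itself. -/
theorem PowerSeries.exists_sub_algebraMap_mem_maximalIdeal {K B : Type*} [Field K] [IsAlgClosed K]
    [CommRing B] [Algebra K B] [Algebra (PowerSeries K) B] [IsScalarTower K (PowerSeries K) B]
    [Module.Finite (PowerSeries K) B] [FaithfulSMul (PowerSeries K) B] [IsLocalRing B] (b : B) :
    ∃ c : K, b - algebraMap K B c ∈ IsLocalRing.maximalIdeal B := by
  have : Module.Finite K (IsLocalRing.ResidueField B) := by
    have : Module.Finite (PowerSeries K) (IsLocalRing.ResidueField B) :=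
      Module.Finite.of_surjective (IsScalarTower.toAlgHom (PowerSeries K) B _).toLinearMap
        IsLocalRing.residue_surjective
    refine PowerSeries.moduleFinite_of_X_smul_eq_zero fun x => ?_
    rw [Algebra.smul_def, IsScalarTower.algebraMap_apply (PowerSeries K) B]
    have := PowerSeries.not_isUnit_algebraMap_X (K := K) (B := B)
    rw [IsLocalRing.ResidueField.algebraMap_eq, (IsLocalRing.residue_eq_zero_iff _).mpr this,
      zero_mul]
  obtain ⟨c, hc⟩ := (IsAlgClosed.algebraMap_bijective_of_isIntegral (k := K)
    (K := IsLocalRing.ResidueField B)).2 (IsLocalRing.residue B b)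
  refine ⟨c, ?_⟩
  rw [← IsLocalRing.residue_eq_zero_iff, map_sub, ← hc, sub_eq_zero,
    IsScalarTower.algebraMap_apply K B, IsLocalRing.ResidueField.algebraMap_eq]

/-! ### The valuation of a branch. -/

/-- The properties of the normalized valuation on the local ring `A` of a branch. -/
structure IsBranchValue (K : Type*) [Field K] {A : Type*} [CommRing A] [Algebra K A]
    (v : AddValuation A ℕ∞) : Prop where
  eq_top_iff : ∀ a, v a = ⊤ ↔ a = 0
  eq_zero_iff : ∀ a, v a = 0 ↔ IsUnit a
  exists_lt_sub : ∀ a b, v a = v b → v a ≠ ⊤ → ∃ c : K, c ≠ 0 ∧ v a < v (a - c • b)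
  exists_dvd : ∀ a, a ≠ 0 → ∃ N : ℕ, ∀ x, (N : ℕ∞) ≤ v x → a ∣ x
  exists_eq : ∃ N : ℕ, ∀ m : ℕ∞, (N : ℕ∞) ≤ m → ∃ x, v x = m

section Branch

variable {K : Type*} [Field K] {A : Type*} [CommRing A] [Algebra K A] {B : Type*} [CommRing B]
  [IsDomain B] [IsDiscreteValuationRing B] [Algebra K B] [Algebra A B] [IsScalarTower K A B]

open IsDiscreteValuationRing in
-- The element `d` lies in the conductor: anything of value at least that of `a * d` is `a * d * b`
-- with `b ∈ B`, and `d * b` comes from `A`. Leading terms cancel because the unit relating two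
-- elements of equal value is a constant modulo the maximal ideal.
theorem isBranchValue_addVal [FaithfulSMul A B] [Algebra.IsIntegral A B]
    (hres : ∀ b : B, ∃ c : K, b - algebraMap K B c ∈ IsLocalRing.maximalIdeal B)
    (hcond : ∃ d : A, d ≠ 0 ∧ ∀ b : B, ∃ a, algebraMap A B a = d • b) :
    IsBranchValue K ((addVal B).comap (algebraMap A B)) := by
  have hinj := FaithfulSMul.algebraMap_injective A B
  have hne : ∀ a : A, a ≠ 0 → algebraMap A B a ≠ 0 := fun a ha => by simpa using hinj.ne ha
  obtain ⟨d, hd, hdB⟩ := hcond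
  have hcomap : ∀ a : A, (addVal B).comap (algebraMap A B) a = addVal B (algebraMap A B a) :=
    fun a => rfl
  have hdvd : ∀ a : A, a ≠ 0 → ∃ N : ℕ, (addVal B (algebraMap A B (a * d)) = N) ∧
      ∀ x, (N : ℕ∞) ≤ addVal B x → ∃ y, x = algebraMap A B (a * y) := by
    intro a ha
    have h0 : algebraMap A B (a * d) ≠ 0 := by
      rw [map_mul]
      exact mul_ne_zero (hne a ha) (hne d hd)
    obtain ⟨N, hN⟩ := ENat.ne_top_iff_exists.mp (mt addVal_eq_top_iff.mp h0)
    refine ⟨N, hN.symm, fun x hx => ?_⟩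
    rw [hN, addVal_le_iff_dvd] at hx
    obtain ⟨b, rfl⟩ := hx
    obtain ⟨y, hy⟩ := hdB b
    exact ⟨y, by rw [map_mul, map_mul, hy, Algebra.smul_def, mul_assoc]⟩
  refine ⟨fun a => ?_, fun a => ?_, fun a b hab ha => ?_, fun a ha => ?_, ?_⟩
  · rw [hcomap, addVal_eq_top_iff, map_eq_zero_iff _ hinj]
  · have := Algebra.IsIntegral.isLocalHom (R := A) (S := B)
    rw [hcomap, addVal_eq_zero_iff, isUnit_map_iff]
  · simp only [hcomap] at hab ha ⊢
    obtain ⟨u, hu⟩ := (addVal_eq_iff_associated _ _).mp hab.symm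
    obtain ⟨c, hc⟩ := hres u
    have hlt : addVal B (algebraMap A B a) < addVal B (algebraMap A B (a - c • b)) := by
      have h1 : algebraMap A B (a - c • b) = algebraMap A B b * (u - algebraMap K B c) := by
        rw [map_sub, ← hu, Algebra.smul_def, map_mul, ← IsScalarTower.algebraMap_apply]
        ring
      rw [h1, addVal_mul, hab]
      conv_lhs => rw [← add_zero (addVal B (algebraMap A B b))]
      rw [ENat.add_lt_add_iff_left (hab ▸ ha), pos_iff_ne_zero, Ne, addVal_eq_zero_iff]
      exact hc
    refine ⟨c, ?_, hlt⟩
    rintro rfl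
    simp at hlt
  · obtain ⟨N, -, hN⟩ := hdvd a ha
    refine ⟨N, fun x hx => ?_⟩
    obtain ⟨y, hy⟩ := hN _ hx
    exact ⟨y, hinj hy⟩
  · have : Nontrivial A := ⟨d, 0, hd⟩
    obtain ⟨N, -, hN⟩ := hdvd 1 one_ne_zero
    obtain ⟨p, hp⟩ := exists_irreducible B
    refine ⟨N, fun m hm => ?_⟩
    have : ∃ b : B, addVal B b = m := by
      cases m with
      | top => exact ⟨0, addVal_zero⟩
      | coe m => exact ⟨p ^ m, hp.addVal_pow m⟩
    obtain ⟨b, rfl⟩ := this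
    obtain ⟨y, rfl⟩ := hN b hm
    exact ⟨1 * y, rfl⟩

end Branch

theorem isBranchValue_normalizedValue {K : Type*} [Field K] [IsAlgClosed K] {A : Type*} [CommRing A]
    [IsDomain A] [Algebra K A] [Algebra (PowerSeries K) A] [IsScalarTower K (PowerSeries K) A]
    [Module.Finite (PowerSeries K) A] [FaithfulSMul (PowerSeries K) A] :
    ∃ v : AddValuation A ℕ∞, (∀ a, normalizedValue a = v a) ∧ IsBranchValue K v := by
  let B := integralClosure A (FractionRing A)
  have : IsIntegrallyClosed B :=
    integralClosure.isIntegrallyClosedOfFiniteExtension (FractionRing A)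
  have : FaithfulSMul A B :=
    inferInstanceAs (FaithfulSMul A (integralClosure A (FractionRing A)))
  have : FaithfulSMul (PowerSeries K) B := .trans (PowerSeries K) A B
  have : Algebra.IsIntegral (PowerSeries K) B := Algebra.IsIntegral.trans A
  have hden : ∀ s : Finset B, ∃ a : A, a ≠ 0 ∧ ∀ b ∈ s, ∃ a', algebraMap A B a' = a • b := by
    classical
    intro s
    obtain ⟨a, ha⟩ := IsLocalization.exist_integer_multiples_of_finset (nonZeroDivisors A)
      (s.image ((↑) : B → FractionRing A))
    refine ⟨a, nonZeroDivisors.coe_ne_zero a, fun b hb => ?_⟩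
    obtain ⟨a', ha'⟩ := ha b (Finset.mem_image_of_mem _ hb)
    exact ⟨a', Subtype.ext ha'⟩
  have : Module.Finite (PowerSeries K) B := PowerSeries.moduleFinite_of_birational (A := A) hden
  have : IsDiscreteValuationRing B :=
    PowerSeries.isDiscreteValuationRing_of_moduleFinite (K := K)
  refine ⟨(IsDiscreteValuationRing.addVal B).comap (algebraMap A B),
    fun a => radicalOrder_eq_addVal _, isBranchValue_addVal
      PowerSeries.exists_sub_algebraMap_mem_maximalIdeal ?_⟩
  obtain ⟨s, hs⟩ := (Module.Finite.fg_top (R := PowerSeries K) (M := B))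
  obtain ⟨d, hd, h⟩ := hden s
  refine ⟨d, hd, fun b => ?_⟩
  have hb : b ∈ Submodule.span (PowerSeries K) (s : Set B) := hs ▸ Submodule.mem_top
  induction hb using Submodule.span_induction with
  | mem x hx => exact h x hx
  | zero => exact ⟨0, by simp⟩
  | add x y _ _ hx hy =>
    obtain ⟨a, ha⟩ := hx
    obtain ⟨b, hb⟩ := hy
    exact ⟨a + b, by rw [map_add, ha, hb, smul_add]⟩
  | smul f x _ hx =>
    obtain ⟨a, ha⟩ := hx
    refine ⟨f • a, ?_⟩
    rw [Algebra.smul_def, map_mul, ha, ← IsScalarTower.algebraMap_apply, ← Algebra.smul_def,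
      smul_comm]

/-! ### Quotients of the power series ring by a branch. -/

namespace MvPowerSeries

variable {K : Type*} [Field K] {n : ℕ}

theorem mem_span_range_X {f : MvPowerSeries (Fin n) K} (hf : constantCoeff f = 0) :
    f ∈ Ideal.span (Set.range (X : Fin n → MvPowerSeries (Fin n) K)) := by
  classical
  -- `g i * X i` collects the monomials of `f` in which `X i` is the variable of least index that
  -- occurs.
  let g : Fin n → MvPowerSeries (Fin n) K := fun i m =>
    if ∀ j < i, m j = 0 then coeff (m + Finsupp.single i 1) f else 0
  have hg : ∀ i m, coeff m (g i) =
      if ∀ j < i, m j = 0 then coeff (m + Finsupp.single i 1) f else 0 := fun i m => rfl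
  have hfg : f = ∑ i, g i * X i := by
    ext m
    rw [map_sum]
    simp_rw [X_def, coeff_mul_monomial, hg, mul_one]
    by_cases hm : m = 0
    · subst hm
      simpa using hf
    · have hne : m.support.Nonempty := Finsupp.support_nonempty_iff.mpr hm
      set i := m.support.min' hne
      have hi : m i ≠ 0 := Finsupp.mem_support_iff.mp (m.support.min'_mem hne)
      have hlt : ∀ j < i, m j = 0 := fun j hj => by
        by_contra h
        exact absurd (m.support.min'_le j (Finsupp.mem_support_iff.mpr h)) (not_le.mpr hj)
      rw [Finset.sum_eq_single i]
      · have hle : Finsupp.single i 1 ≤ m := by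
          rw [Finsupp.single_le_iff]
          omega
        rw [if_pos hle, tsub_add_cancel_of_le hle, if_pos]
        intro j hj
        simp [hlt j hj]
      · intro j _ hji
        rcases lt_or_gt_of_ne hji with h | h
        · rw [if_neg]
          rw [Finsupp.single_le_iff, hlt j h]
          omega
        · split_ifs with h1 h2
          · have := h2 i h
            simp [hji] at this
            exact absurd this hi
          · rfl
          · rfl
      · simp
  rw [hfg]
  exact Ideal.sum_mem _ fun i _ => Ideal.mul_mem_left _ _ (Ideal.subset_span ⟨i, rfl⟩)

theorem mem_maximalIdeal_iff {f : MvPowerSeries (Fin n) K} :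
    f ∈ IsLocalRing.maximalIdeal (MvPowerSeries (Fin n) K) ↔ constantCoeff f = 0 := by
  rw [IsLocalRing.mem_maximalIdeal, mem_nonunits_iff, isUnit_iff_constantCoeff, isUnit_iff_ne_zero,
    not_not]

theorem maximalIdeal_fg : (IsLocalRing.maximalIdeal (MvPowerSeries (Fin n) K)).FG := by
  have : IsLocalRing.maximalIdeal (MvPowerSeries (Fin n) K) = Ideal.span (Set.range X) := by
    refine le_antisymm (fun f hf => mem_span_range_X (mem_maximalIdeal_iff.mp hf)) ?_
    rw [Ideal.span_le]
    rintro _ ⟨i, rfl⟩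
    exact mem_maximalIdeal_iff.mpr (constantCoeff_X i)
  rw [this]
  exact Submodule.fg_span (Set.finite_range _)

theorem exists_isBranchValue [IsAlgClosed K] (P : Ideal (MvPowerSeries (Fin n) K)) [P.IsPrime]
    (hdim : ringKrullDim (MvPowerSeries (Fin n) K ⧸ P) = 1) :
    ∃ v : AddValuation (MvPowerSeries (Fin n) K ⧸ P) ℕ∞,
      (∀ a, normalizedValue a = v a) ∧ IsBranchValue K v := by
  let S := MvPowerSeries (Fin n) K
  let A := S ⧸ P
  have : IsLocalRing A :=
    IsLocalRing.of_surjective' (Ideal.Quotient.mk P) Ideal.Quotient.mk_surjective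
  have : Ring.KrullDimLE 1 A := Ring.krullDimLE_iff.mpr hdim.le
  have hunit : ∀ f : S, constantCoeff f = 0 → Ideal.Quotient.mk P f ∈ IsLocalRing.maximalIdeal A := by
    intro f hf
    have := IsLocalHom.of_surjective (Ideal.Quotient.mk P) Ideal.Quotient.mk_surjective
    exact (IsLocalRing.mem_maximalIdeal _).mpr fun h =>
      (IsLocalRing.mem_maximalIdeal _).mp (mem_maximalIdeal_iff.mpr hf) (this.map_nonunit _ h)
  have hmem : ∀ f : S, Ideal.Quotient.mk P f ∈ IsLocalRing.maximalIdeal A → constantCoeff f = 0 := by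
    intro f hf
    by_contra h
    exact (IsLocalRing.mem_maximalIdeal _).mp hf
      ((isUnit_iff_constantCoeff.mpr (isUnit_iff_ne_zero.mpr h)).map _)
  have hfg : (IsLocalRing.maximalIdeal A).FG := by
    have : IsLocalRing.maximalIdeal A =
        (IsLocalRing.maximalIdeal S).map (Ideal.Quotient.mk P) := by
      refine le_antisymm (fun x hx => ?_) ?_
      · obtain ⟨f, rfl⟩ := Ideal.Quotient.mk_surjective x
        exact Ideal.mem_map_of_mem _ (mem_maximalIdeal_iff.mpr (hmem f hx))
      · rw [Ideal.map_le_iff_le_comap]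
        exact fun f hf => hunit f (mem_maximalIdeal_iff.mp hf)
    rw [this]
    exact maximalIdeal_fg.map _
  have hres : ∀ a : A, ∃ c : K, a - algebraMap K A c ∈ IsLocalRing.maximalIdeal A := by
    intro a
    obtain ⟨f, rfl⟩ := Ideal.Quotient.mk_surjective a
    refine ⟨constantCoeff f, ?_⟩
    rw [show algebraMap K A (constantCoeff f) = Ideal.Quotient.mk P (C (constantCoeff f)) from rfl,
      ← map_sub]
    exact hunit _ (by simp)
  have hbot : IsLocalRing.maximalIdeal A ≠ ⊥ := by
    intro h
    have := ringKrullDim_eq_zero_of_isField (IsLocalRing.isField_iff_maximalIdeal_eq.mpr h)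
    rw [hdim] at this
    exact one_ne_zero this
  obtain ⟨t, ht, ht0⟩ := Submodule.exists_mem_ne_zero_of_ne_bot hbot
  obtain ⟨T, rfl⟩ := Ideal.Quotient.mk_surjective t
  -- Substituting a nonzero non-unit for `X` gives the required `K⟦X⟧`-structure.
  let φ : PowerSeries K →ₐ[K] A := (Ideal.Quotient.mkₐ K P).comp
    (PowerSeries.substAlgHom (PowerSeries.HasSubst.of_constantCoeff_zero (hmem T ht)))
  let : Algebra (PowerSeries K) A := φ.toRingHom.toAlgebra
  have hX : algebraMap (PowerSeries K) A PowerSeries.X = Ideal.Quotient.mk P T := by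
    change φ PowerSeries.X = _
    simp only [φ, AlgHom.comp_apply, PowerSeries.substAlgHom_X]
    rfl
  have : IsScalarTower K (PowerSeries K) A := IsScalarTower.of_algebraMap_eq fun c =>
    (φ.commutes c).symm
  have : Module.Finite (PowerSeries K) A :=
    PowerSeries.moduleFinite_of_krullDimLE_one hfg hres (hX ▸ ht) (hX ▸ ht0)
  have : FaithfulSMul (PowerSeries K) A := (faithfulSMul_iff_algebraMap_injective _ _).mpr
    (PowerSeries.algebraMap_injective_of_ne_zero (hX ▸ ht0))
  exact isBranchValue_normalizedValue

end MvPowerSeries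

/-! ### Values on the whole curve. -/

namespace AlgebroidCurve

variable {K : Type*} [Field K] {n r : ℕ} (C : AlgebroidCurve K n r)

/-- The projection of the local ring of the curve to the local ring of its `i`-th branch. -/
noncomputable abbrev toBranch (i : Fin r) : C.LocalRing →+* MvPowerSeries (Fin n) K ⧸ C.P i :=
  Ideal.Quotient.factor (C.Q_le_P i)

theorem isPrime_P (i : Fin r) : (C.P i).IsPrime := by
  have h : C.P i ∈ C.Q.minimalPrimes := C.range_P ▸ Set.mem_range_self i
  exact h.1.1

theorem toBranch_surjective (i : Fin r) : Function.Surjective (C.toBranch i) :=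
  Ideal.Quotient.factor_surjective (C.Q_le_P i)

theorem toBranch_smul (i : Fin r) (c : K) (g : C.LocalRing) :
    C.toBranch i (c • g) = c • C.toBranch i g := by
  obtain ⟨f, rfl⟩ := Ideal.Quotient.mk_surjective g
  rfl

theorem eq_zero_of_toBranch_eq_zero {g : C.LocalRing} (h : ∀ i, C.toBranch i g = 0) : g = 0 := by
  obtain ⟨f, rfl⟩ := Ideal.Quotient.mk_surjective g
  rw [Ideal.Quotient.eq_zero_iff_mem, ← C.isRadical.radical, ← Ideal.sInf_minimalPrimes,
    ← C.range_P, Submodule.mem_sInf]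
  rintro _ ⟨i, rfl⟩
  exact Ideal.Quotient.eq_zero_iff_mem.mp (by simpa using h i)

theorem isUnit_of_isUnit_toBranch {g : C.LocalRing} (i : Fin r) (h : IsUnit (C.toBranch i g)) :
    IsUnit g := by
  have := Ideal.Quotient.nontrivial_iff.mpr (C.isPrime_P i).ne_top
  exact (IsLocalHom.of_surjective (C.toBranch i) (C.toBranch_surjective i)).map_nonunit _ h

/-- A prime containing a finite intersection of ideals contains one of them, and distinct minimal
primes are incomparable. -/
theorem exists_toBranch_ne_zero (i : Fin r) :
    ∃ g, C.toBranch i g ≠ 0 ∧ ∀ j ≠ i, C.toBranch j g = 0 := by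
  have hle : ¬ (Finset.univ.erase i).inf C.P ≤ C.P i := by
    intro h
    obtain ⟨j, hj, hji⟩ := (C.isPrime_P i).inf_le'.mp h
    have hi : C.P i ∈ C.Q.minimalPrimes := C.range_P ▸ Set.mem_range_self i
    exact (Finset.ne_of_mem_erase hj)
      (C.injective_P (le_antisymm hji (hi.2 ⟨C.isPrime_P j, C.Q_le_P j⟩ hji)))
  obtain ⟨f, hf, hfi⟩ := SetLike.not_le_iff_exists.mp hle
  refine ⟨Ideal.Quotient.mk C.Q f, ?_, fun j hj => ?_⟩
  · rw [Ideal.Quotient.factor_mk]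
    exact mt Ideal.Quotient.eq_zero_iff_mem.mp hfi
  · rw [Ideal.Quotient.factor_mk]
    refine Ideal.Quotient.eq_zero_iff_mem.mpr ?_
    exact (Submodule.mem_finsetInf.mp hf) j (Finset.mem_erase.mpr ⟨hj, Finset.mem_univ j⟩)

variable [IsAlgClosed K]

theorem exists_valuations : ∃ v : ∀ i, AddValuation (MvPowerSeries (Fin n) K ⧸ C.P i) ℕ∞,
    (∀ g i, C.value g i = v i (C.toBranch i g)) ∧ ∀ i, IsBranchValue K (v i) := by
  have := C.isPrime_P
  choose v hv hB using fun i => MvPowerSeries.exists_isBranchValue (C.P i) (C.dim_eq_one i)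
  exact ⟨v, fun g i => hv i _, hB⟩

theorem value_zero : C.value 0 = ⊤ := by
  obtain ⟨v, hv, -⟩ := C.exists_valuations
  funext i
  rw [hv, map_zero, AddValuation.map_zero, Pi.top_apply]

theorem value_one : C.value 1 = 0 := by
  obtain ⟨v, hv, -⟩ := C.exists_valuations
  funext i
  rw [hv, map_one, AddValuation.map_one, Pi.zero_apply]

theorem value_mul (g h : C.LocalRing) : C.value (g * h) = C.value g + C.value h := by
  obtain ⟨v, hv, -⟩ := C.exists_valuations
  funext i
  rw [Pi.add_apply, hv, hv, hv, map_mul, AddValuation.map_mul]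

theorem eq_zero_of_value_eq_top {g : C.LocalRing} (h : C.value g = ⊤) : g = 0 := by
  obtain ⟨v, hv, hB⟩ := C.exists_valuations
  refine C.eq_zero_of_toBranch_eq_zero fun i => ((hB i).eq_top_iff _).mp ?_
  rw [← hv, h, Pi.top_apply]

theorem value_eq_zero_of_isUnit {g : C.LocalRing} (h : IsUnit g) : C.value g = 0 := by
  obtain ⟨v, hv, hB⟩ := C.exists_valuations
  funext i
  rw [hv, Pi.zero_apply, (hB i).eq_zero_iff]
  exact h.map _

theorem value_smul {c : K} (hc : c ≠ 0) (g : C.LocalRing) : C.value (c • g) = C.value g := by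
  rw [show c • g = algebraMap K C.LocalRing c * g from Algebra.smul_def c g, C.value_mul,
    C.value_eq_zero_of_isUnit, zero_add]
  exact (isUnit_iff_ne_zero.mpr hc).map _

theorem min_le_value_sub (g h : C.LocalRing) (i : Fin r) :
    min (C.value g i) (C.value h i) ≤ C.value (g - h) i := by
  obtain ⟨v, hv, -⟩ := C.exists_valuations
  simp only [hv, map_sub]
  exact (v i).map_sub _ _

theorem value_sub_eq_min {g h : C.LocalRing} {i : Fin r} (hne : C.value g i ≠ C.value h i) :
    C.value (g - h) i = min (C.value g i) (C.value h i) := by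
  obtain ⟨v, hv, -⟩ := C.exists_valuations
  simp only [hv, map_sub] at hne ⊢
  rcases lt_or_gt_of_ne hne with h | h
  · rw [(v i).map_sub_eq_of_lt_left h, min_eq_left h.le]
  · rw [(v i).map_sub_eq_of_lt_right h, min_eq_right h.le]

theorem exists_value_lt_sub_smul {g h : C.LocalRing} {k : Fin r} (hk : C.value g k = C.value h k)
    (htop : C.value g k ≠ ⊤) : ∃ c : K, c ≠ 0 ∧ C.value g k < C.value (g - c • h) k := by
  obtain ⟨v, hv, hB⟩ := C.exists_valuations
  simp only [hv, map_sub, toBranch_smul] at hk htop ⊢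
  exact (hB k).exists_lt_sub _ _ hk htop

/-- Elements of large value on a branch extend by zero to the other branches. -/
theorem exists_extension_by_zero (i : Fin r) : ∃ N : ℕ,
    (∀ g, (N : ℕ∞) ≤ C.value g i → ∃ h, C.toBranch i h = C.toBranch i g ∧
      ∀ j ≠ i, C.toBranch j h = 0) ∧
    ∀ m : ℕ∞, (N : ℕ∞) ≤ m → ∃ h, C.value h i = m ∧ ∀ j ≠ i, C.toBranch j h = 0 := by
  obtain ⟨v, hv, hB⟩ := C.exists_valuations
  obtain ⟨a, ha, haj⟩ := C.exists_toBranch_ne_zero i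
  obtain ⟨N, hN⟩ := (hB i).exists_dvd _ ha
  obtain ⟨N', hN'⟩ := (hB i).exists_eq
  have key : ∀ g, (N : ℕ∞) ≤ C.value g i → ∃ h, C.toBranch i h = C.toBranch i g ∧
      ∀ j ≠ i, C.toBranch j h = 0 := by
    intro g hg
    obtain ⟨y, hy⟩ := hN _ (hv g i ▸ hg)
    obtain ⟨y, rfl⟩ := C.toBranch_surjective i y
    exact ⟨a * y, by rw [map_mul, hy], fun j hj => by rw [map_mul, haj j hj, zero_mul]⟩
  refine ⟨max N N', fun g hg => key g (le_trans (by simp) hg), fun m hm => ?_⟩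
  obtain ⟨x, hx⟩ := hN' m (le_trans (by simp) hm)
  obtain ⟨g, rfl⟩ := C.toBranch_surjective i x
  obtain ⟨h, hh, hj⟩ := key g (by rw [hv, hx]; exact le_trans (by simp) hm)
  exact ⟨h, by rw [hv, hh, hx], hj⟩

theorem isGoodSemigroup_semiringOfValues : IsGoodSemigroup C.semiringOfValues where
  zero_mem := ⟨1, C.value_one⟩
  add_mem := by
    rintro _ ⟨g, rfl⟩ _ ⟨h, rfl⟩
    exact ⟨g * h, C.value_mul g h⟩
  top_mem := ⟨0, C.value_zero⟩
  eq_zero := by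
    rintro _ ⟨g, rfl⟩ k hk
    obtain ⟨v, hv, hB⟩ := C.exists_valuations
    rw [hv, (hB k).eq_zero_iff] at hk
    exact C.value_eq_zero_of_isUnit (C.isUnit_of_isUnit_toBranch k hk)
  exists_lt := by
    rintro _ ⟨g, rfl⟩ _ ⟨h, rfl⟩ k hk htop
    obtain ⟨c, hc, hlt⟩ := C.exists_value_lt_sub_smul hk htop
    refine ⟨_, ⟨g - c • h, rfl⟩, hlt, fun i => ?_⟩
    rw [← C.value_smul hc h]
    exact ⟨C.min_le_value_sub _ _ i, C.value_sub_eq_min⟩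
  exists_update_mem := by
    choose N hN hN' using C.exists_extension_by_zero
    refine ⟨Finset.univ.sup N, ?_⟩
    rintro _ ⟨g, rfl⟩ i hi m hm
    have hle : ((N i : ℕ) : ℕ∞) ≤ (Finset.univ.sup N : ℕ) := by
      exact_mod_cast Finset.le_sup (f := N) (Finset.mem_univ i)
    obtain ⟨g', hg', hg'j⟩ := hN i g (hle.trans hi)
    obtain ⟨h, hh, hhj⟩ := hN' i m (hle.trans hm)
    obtain ⟨v, hv, -⟩ := C.exists_valuations
    -- Remove the part of `g` on branch `i` and put there an element of value `m`; the other
    -- branches do not change.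
    refine ⟨g - g' + h, funext fun j => ?_⟩
    by_cases hj : j = i
    · subst hj
      rw [Function.update_self, ← hh, hv, hv, map_add, map_sub, hg', sub_self, zero_add]
    · rw [Function.update_of_ne hj, hv, hv, map_add, map_sub, hg'j j hj, hhj j hj, sub_zero, add_zero]

/-! ### Reductions and standard bases. -/

theorem value_mem_closure {G : Set C.LocalRing} {p : C.LocalRing} (hp : p ∈ Submonoid.closure G) :
    C.value p ∈ AddSubmonoid.closure (C.value '' G) := by
  induction hp using Submonoid.closure_induction with
  | mem x hx => exact AddSubmonoid.subset_closure ⟨x, hx, rfl⟩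
  | one => exact C.value_one ▸ zero_mem _
  | mul x y _ _ hx hy => exact C.value_mul x y ▸ add_mem hx hy

theorem exists_value_eq_of_mem_closure {G : Set C.LocalRing} {γ : Fin r → ℕ∞}
    (hγ : γ ∈ AddSubmonoid.closure (C.value '' G)) : ∃ p ∈ Submonoid.closure G, C.value p = γ := by
  induction hγ using AddSubmonoid.closure_induction with
  | mem x hx =>
    obtain ⟨g, hg, rfl⟩ := hx
    exact ⟨g, Submonoid.subset_closure hg, rfl⟩
  | zero => exact ⟨1, one_mem _, C.value_one⟩
  | add x y _ _ hx hy =>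
    obtain ⟨p, hp, rfl⟩ := hx
    obtain ⟨q, hq, rfl⟩ := hy
    exact ⟨p * q, mul_mem hp hq, C.value_mul p q⟩

/-- If an element whose value is an irreducible absolute point can be reduced modulo `G`, then its
value is the value of an element of `G`. -/
theorem HasReduction.value_mem_image {G : Set C.LocalRing} {g : C.LocalRing}
    (hg : C.value g ∈ irreducibleAbsolutePoints C.semiringOfValues) (h : C.HasReduction G g) :
    C.value g ∈ C.value '' G := by
  obtain ⟨k, h, hk, ⟨c, p, hp, rfl⟩, hle, hlt⟩ := h
  have hc : c ≠ 0 := by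
    rintro rfl
    simp at hlt
  -- With unequal values at `k`, subtraction could not raise the value of `g` there.
  have hval : C.value p k = C.value g k := by
    rw [← C.value_smul hc p]
    by_contra hne
    rw [C.value_sub_eq_min (Ne.symm hne)] at hlt
    exact absurd hlt (not_lt.mpr (min_le_left _ _))
  have hgp : C.value g ≤ C.value p := by
    intro i
    rw [← C.value_smul hc p]
    calc C.value g i = min (C.value g i) (C.value (g - c • p) i) := (min_eq_left (hle i)).symm
      _ ≤ C.value (g - (g - c • p)) i := C.min_le_value_sub _ _ i
      _ = C.value (c • p) i := by rw [sub_sub_cancel]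
  have heq := IsGoodSemigroup.eq_of_le_of_apply_eq hg.2 ⟨p, rfl⟩ hgp hk hval
  refine C.isGoodSemigroup_semiringOfValues.mem_of_mem_closure ?_ hg.1
    (heq ▸ C.value_mem_closure hp)
  rintro _ ⟨x, -, rfl⟩
  exact ⟨x, rfl⟩

/-- An element can be reduced modulo any set whose values, under sums, include points above its value
which meet it in a finite coordinate. -/
theorem hasReduction_of_mem_closure {G : Set C.LocalRing} {g : C.LocalRing} {k : Fin r}
    (hk : C.value g k ≠ ⊤) {τ : Fin r → ℕ∞} (hτ : τ ∈ AddSubmonoid.closure (C.value '' G))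
    (hle : C.value g ≤ τ) (hτk : τ k = C.value g k) : C.HasReduction G g := by
  obtain ⟨p, hp, rfl⟩ := C.exists_value_eq_of_mem_closure hτ
  obtain ⟨c, hc, hlt⟩ := C.exists_value_lt_sub_smul hτk.symm hk
  refine ⟨k, g - c • p, hk, ⟨c, p, hp, rfl⟩, fun i => ?_, hlt⟩
  refine le_trans ?_ (C.min_le_value_sub g (c • p) i)
  rw [C.value_smul hc, min_eq_left (hle i)]

variable {C} in
theorem IsStandardBasis.irreducibleAbsolutePoints_subset (hr : 2 ≤ r) {G : Set C.LocalRing}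
    (hG : C.IsStandardBasis G) :
    irreducibleAbsolutePoints C.semiringOfValues ⊆ C.value '' G := by
  have hΓ := C.isGoodSemigroup_semiringOfValues
  intro γ hγ
  obtain ⟨g, rfl⟩ := hγ.1.1
  refine HasReduction.value_mem_image C hγ (hG.hasReduction g ?_)
  -- The zero element does not arise, since its value `⊤` is a sum of two points other than `⊤` when
  -- `r ≥ 2`.
  rintro rfl
  obtain ⟨N, hN⟩ := hΓ.exists_update_mem
  have hij : (⟨0, by omega⟩ : Fin r) ≠ ⟨1, by omega⟩ := by simp
  have hmem := fun i => hN ⊤ hΓ.top_mem i le_top N le_rfl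
  have hne : ∀ i : Fin r, Function.update (⊤ : Fin r → ℕ∞) i (N : ℕ∞) ≠ ⊤ := fun i h => by
    simpa using congrFun h i
  rw [C.value_zero] at hγ
  exact (hγ.1.2.2 _ (hmem _) _ (hmem _)
    (IsGoodSemigroup.update_top_add_update_top hij N N).symm).elim (hne _) (hne _)

theorem isMinimal_iff (hr : 2 ≤ r) {G : Set C.LocalRing} (hG : C.IsStandardBasis G)
    (hinj : Set.InjOn C.value G) :
    C.IsMinimal G ↔ C.value '' G = irreducibleAbsolutePoints C.semiringOfValues := by
  have hsub := hG.irreducibleAbsolutePoints_subset hr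
  refine ⟨fun hmin => Set.Subset.antisymm ?_ hsub, fun heq g hg hred => ?_⟩
  · rintro _ ⟨g, hg, rfl⟩
    by_contra hirr
    refine hmin g hg ?_
    have hk : ∃ k, C.value g k ≠ ⊤ := by
      by_contra! h
      exact hG.ne_zero g hg (C.eq_zero_of_value_eq_top (funext h))
    obtain ⟨k, hk⟩ := hk
    have hΓ := C.isGoodSemigroup_semiringOfValues
    obtain ⟨τ, hτ, hle, hτk⟩ := hΓ.exists_isAbsolutePoint ⟨g, rfl⟩ k
    refine C.hasReduction_of_mem_closure hk (AddSubmonoid.closure_mono ?_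
      (hΓ.mem_closure_of_isAbsolutePoint hr hτ)) hle hτk
    intro γ hγ
    obtain ⟨g', hg', rfl⟩ := hsub hγ
    -- `g` is not needed to realize the irreducible absolute points, as its own value is not one of
    -- them.
    exact ⟨g', ⟨hg', fun h => hirr (by rwa [← Set.mem_singleton_iff.mp h])⟩, rfl⟩
  -- A reduction would give another element of `G` with the same value, against distinctness of
  -- values.
  · obtain ⟨g', ⟨hg', hne⟩, h⟩ := HasReduction.value_mem_image C (heq ▸ ⟨g, hg, rfl⟩) hred
    exact hne (hinj hg' hg h)

end AlgebroidCurve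

theorem theorem19 {K : Type*} [Field K] [IsAlgClosed K] {n r : ℕ} (hr : 2 ≤ r)
    (C : AlgebroidCurve K n r) :
    (∀ G : Set C.LocalRing, C.IsStandardBasis G → Set.InjOn C.value G →
      (C.IsMinimal G ↔ C.value '' G = irreducibleAbsolutePoints C.semiringOfValues)) ∧
    (irreducibleAbsolutePoints C.semiringOfValues).Finite ∧
    IsLeast {V | GeneratesSemiring V C.semiringOfValues}
      (irreducibleAbsolutePoints C.semiringOfValues) := by
  have hΓ := C.isGoodSemigroup_semiringOfValues
  exact ⟨fun G hG hinj => C.isMinimal_iff hr hG hinj, hΓ.finite_irreducibleAbsolutePoints,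
    hΓ.generatesSemiring hr, fun V hV => hΓ.irreducibleAbsolutePoints_subset hV⟩
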